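/- **Setting.** Let $N\ge 1$. Vectors $z\in\mathbb C^N$ are rows, $|z|$ is the standard Hermitian norm, and $dL$ is Lebesgue measure (product of the $dx_j\,dy_j$ in unitary coordinates; on a zero-dimensional space it is the unit point mass). Let $\mathcal D_N$ be the set of complex symmetric $N\times N$ matrices $A$ with $A^*A<I$, and put $Q_A(z)=zAz^T$. For a finite-dimensional complex Hermitian space $\mathcal H$, let $\mathcal D(\mathcal H)$ be the set of complex quadratic forms $Q:\mathcal H\to\mathbb C$ with $e^{Q/2}e^{-\|\cdot\|^2/2}\in L^2(\mathcal H)$. For $k\in\mathbb N$, $A\in\mathcal D_N$ and $w\in\mathbb C^N$ with $|w|=1$, let $$\psi_{A,w}(z)=e^{kQ_A(z-w)/2}\,e^{kz\overline w^T}\,e^{-k|w|^2/2}\,e^{-k|z|^2/2},\qquad \Psi_{A,w}(z)=\mathcal R_k(\psi_{A,w})(z)=\frac1{2\pi}\int_0^{2\pi}e^{-ikt}\,\psi_{A,w}(e^{it}z)\,dt\quad(z\in\mathbb C^N).$$ Restricted to $S^{2N-1}=\{|z|=1\}$ this is the reduced state. Since $\Psi_{A,w}(e^{i\theta}z)=e^{ik\theta}\Psi_{A,w}(z)$,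 it defines the section $\pi(z)\mapsto[(z,\Psi_{A,w}(z))]_k$ of the Hermitian line bundle $\mathcal L^k=(S^{2N-1}\times\mathbb C)/{\sim_k}\to\mathbb{CP}^{N-1}$, where $(e^{i\theta}z,\lambda)\sim_k(z,e^{-ik\theta}\lambda)$ and $|[(z,\lambda)]_k|=|\lambda|$, and $\pi:S^{2N-1}\to\mathbb{CP}^{N-1}$ is the Hopf fibration. The micro-support (semi-classical wave-front set) of a sequence of states is the complement of the set of points having a neighbourhood on which the pointwise norm of the $k$-th state is uniformly $O(k^{-M})$ as $k\to\infty$, for every $M$. Let $\mathcal H_w=(\mathbb Cw)^\perp$ be the Hermitian orthogonal complement of $\mathbb C w$. **Theorem 1.2.** Let $A\in\mathcal D_N$ and $|w|=1$. 1. The micro-support of $\Psi_{A,w}$ as $k\to\infty$, as a function on $\mathbb C^N$ and as a function on $S^{2N-1}$, is the $S^1$-orbit $\{e^{it}w:\ t\in[0,2\pi]\}$; as a section of $\mathcal L^k\to\mathbb{CP}^{N-1}$ it is the single point $\pi(w)$. 2. For every $\eta\in\mathcal H_w$ the limit below exists, the integral converges absolutely, and $$\sigma_A(\eta):=\lim_{k\to\infty}\sqrt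 k\,\Psi_{A,w}\bigl(w+\eta/\sqrt k\bigr)=\frac1{2\pi}e^{-|\eta|^2/2}\int_{-\infty}^{\infty}e^{Q_A(isw+\eta)/2}\,e^{-s^2/2}\,ds .$$ Moreover $\operatorname{Re}(Q_A(w)+1)>0$ and there is $Q_{\rho_w(A)}\in\mathcal D(\mathcal H_w)$ such that for all $\eta\in\mathcal H_w$ $$\sigma_A(\eta)=\frac1{\sqrt{2\pi}}\,\frac1{\sqrt{Q_A(w)+1}}\;e^{Q_{\rho_w(A)}(\eta)/2}\,e^{-|\eta|^2/2},$$ with the principal branch of the square root. 3. For every $B\in\mathcal D_N$ the function $\sigma_A\overline{\sigma_B}$ is integrable on $\mathcal H_w$ and, as $k\to\infty$, $$\langle\Psi_{A,w},\Psi_{B,w}\rangle=\frac{2\pi}{k^N}\int_{\mathcal H_w}\sigma_A(\eta)\,\overline{\sigma_B(\eta)}\,dL(\eta)+O(k^{-N-1}),$$ where the inner product is that of $L^2(S^{2N-1})$ for the surface measure of the unit sphere. The constant in $O$ may depend on $A,B,w,N$. -/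

import Mathlib

open Filter Topology MeasureTheory Asymptotics
open scoped ComplexConjugate ComplexOrder Matrix

noncomputable section

namespace ReducedGaussian

/-- `ℂ^N` with its standard Hermitian norm. -/
abbrev Cn (N : ℕ) : Type := EuclideanSpace ℂ (Fin N)

/-- The unit sphere `S^{2N-1}` of `ℂ^N`. -/
abbrev Sph (N : ℕ) : Type := Metric.sphere (0 : Cn N) 1

/-- Lebesgue measure of a finite-dimensional complex inner product space, i.e. the measure for
which the unit cube of an orthonormal basis over `ℝ`, for the real part of the Hermitian product,
has volume one. On `ℂ^n` it is the product of the measures `dx_j dy_j`. -/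
def lebesgue (H : Type*) [NormedAddCommGroup H] [InnerProductSpace ℂ H] [FiniteDimensional ℂ H]
    [MeasurableSpace H] [BorelSpace H] : Measure H :=
  letI : InnerProductSpace ℝ H := InnerProductSpace.rclikeToReal ℂ H
  measureSpaceOfInnerProductSpace.volume

/-- The generalized unit disk `𝒟_N`: complex symmetric matrices with `A^* A < I`. -/
def disk (N : ℕ) : Set (Matrix (Fin N) (Fin N) ℂ) :=
  {A | A.IsSymm ∧ (1 - Aᴴ * A).PosDef}

/-- The coordinate-free disk `𝒟(H)`: complex quadratic forms `Q` on `H` for which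
`e^{Q/2}` times the standard Gaussian `e^{-‖v‖²/2}` is square-integrable. -/
def formDisk (H : Type*) [NormedAddCommGroup H] [InnerProductSpace ℂ H] [FiniteDimensional ℂ H]
    [MeasurableSpace H] [BorelSpace H] : Set (QuadraticForm ℂ H) :=
  {Q | MemLp (fun v : H => Complex.exp (Q v / 2) * Complex.exp (-(‖v‖ : ℂ) ^ 2 / 2)) 2
    (lebesgue H)}

/-- `Q_A(z) = z A z^T`. -/
def quad {N : ℕ} (A : Matrix (Fin N) (Fin N) ℂ) (z : Cn N) : ℂ :=
  ∑ i, ∑ j, z i * A i j * z j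

/-- The Gaussian coherent state
`ψ_{A,w}(z) = e^{k Q_A(z-w)/2} e^{k z w̄^T} e^{-k|w|²/2} e^{-k|z|²/2}`. -/
def coherent {N : ℕ} (k : ℕ) (A : Matrix (Fin N) (Fin N) ℂ) (w z : Cn N) : ℂ :=
  Complex.exp (k * quad A (z - w) / 2) * Complex.exp (k * ∑ i, z i * (starRingEnd ℂ) (w i)) *
    Complex.exp (-k * (‖w‖ : ℂ) ^ 2 / 2) * Complex.exp (-k * (‖z‖ : ℂ) ^ 2 / 2)

/-- The quantum reduction operator, given by averaging over the circle. The formula is used at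
every point of `ℂ^N`; the reduced state proper is its restriction to the unit sphere. -/
def reduction {N : ℕ} (k : ℕ) (ψ : Cn N → ℂ) (z : Cn N) : ℂ :=
  (1 / (2 * Real.pi) : ℂ) * ∫ t in (0 : ℝ)..(2 * Real.pi),
    Complex.exp (-Complex.I * k * t) * ψ (Complex.exp (Complex.I * t) • z)

/-- The reduced state `Ψ_{A,w} = R_k(ψ_{A,w})`. -/
def reducedState {N : ℕ} (k : ℕ) (A : Matrix (Fin N) (Fin N) ℂ) (w : Cn N) : Cn N → ℂ :=
  reduction k (coherent k A w)

/-! ### Projective space and the powers of the hyperplane bundle -/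

/-- The action of `e^{iθ}` on the unit sphere. -/
def rotate {N : ℕ} (θ : ℝ) (z : Sph N) : Sph N :=
  ⟨Complex.exp (Complex.I * θ) • (z : Cn N), by
    have hz : ‖(z : Cn N)‖ = 1 := by simp
    have h : ‖Complex.exp (Complex.I * θ)‖ = 1 := by
      rw [mul_comm]; exact Complex.norm_exp_ofReal_mul_I θ
    simp [norm_smul, h, hz]⟩

/-- The projective space `ℂP^{N-1}`. -/
abbrev CP (N : ℕ) : Type := Projectivization ℂ (Cn N)

/-- The Hopf fibration `π : S^{2N-1} → ℂP^{N-1}`. -/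
def hopf {N : ℕ} (z : Sph N) : CP N :=
  Projectivization.mk ℂ (z : Cn N) (fun h => by
    have hz : ‖(z : Cn N)‖ = 1 := by simp
    simp [h] at hz)

/-- `ℂP^{N-1}` has the quotient topology of the Hopf fibration. -/
instance instTopologicalSpaceCP (N : ℕ) : TopologicalSpace (CP N) :=
  TopologicalSpace.coinduced (hopf (N := N)) inferInstance

/-- The relation `(e^{iθ} z, λ) ∼_k (z, e^{-ikθ} λ)` on `S^{2N-1} × ℂ`. -/
def bundleSetoid (N k : ℕ) : Setoid (Sph N × ℂ) where
  r p q := ∃ θ : ℝ, p.1 = rotate θ q.1 ∧ q.2 = Complex.exp (-Complex.I * k * θ) * p.2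
  iseqv :=
    { refl := fun p => ⟨0, Subtype.ext (by simp [rotate]), by simp⟩
      symm := by
        rintro ⟨z, a⟩ ⟨z', a'⟩ ⟨θ, h1, h2⟩
        dsimp only at h1 h2
        subst h1 h2
        refine ⟨-θ, Subtype.ext ?_, ?_⟩
        · simp [rotate, smul_smul, ← Complex.exp_add]
        · dsimp only
          rw [← mul_assoc, ← Complex.exp_add]
          simp
      trans := by
        rintro ⟨z, a⟩ ⟨z', a'⟩ ⟨z'', a''⟩ ⟨θ, h1, h2⟩ ⟨θ', h3, h4⟩
        dsimp only at h1 h2 h3 h4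
        subst h3 h1 h2 h4
        refine ⟨θ + θ', Subtype.ext ?_, ?_⟩
        · simp [rotate, smul_smul, ← Complex.exp_add, mul_add]
        · dsimp only
          rw [← mul_assoc, ← Complex.exp_add]
          congr 2
          push_cast
          ring }

/-- The total space of the line bundle `ℒ^k → ℂP^{N-1}`. -/
def Bundle (N k : ℕ) : Type := Quotient (bundleSetoid N k)

/-- The class `[(z, λ)]_k`. -/
def Bundle.mk {N : ℕ} (k : ℕ) (z : Sph N) (a : ℂ) : Bundle N k :=
  Quotient.mk (bundleSetoid N k) (z, a)

/-- The Hermitian norm of a point of `ℒ^k`: `|[(z, λ)]_k| = |λ|`. -/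
def Bundle.size {N k : ℕ} : Bundle N k → ℝ :=
  Quotient.lift (fun p => ‖p.2‖) (by
    rintro ⟨z, a⟩ ⟨z', a'⟩ ⟨θ, -, h2⟩
    dsimp only at h2
    have h : ‖Complex.exp (-Complex.I * k * θ)‖ = 1 := by
      have e : -Complex.I * k * θ = ((-(k * θ) : ℝ) : ℂ) * Complex.I := by push_cast; ring
      rw [e]; exact Complex.norm_exp_ofReal_mul_I _
    change ‖a‖ = ‖a'‖
    rw [h2, norm_mul, h, one_mul])

theorem hopf_rotate {N : ℕ} (θ : ℝ) (z : Sph N) : hopf (rotate θ z) = hopf z :=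
  (Projectivization.mk_eq_mk_iff' ℂ _ _ _ _).2 ⟨Complex.exp (Complex.I * θ), rfl⟩

/-- The bundle projection `ℒ^k → ℂP^{N-1}`. -/
def Bundle.proj {N k : ℕ} : Bundle N k → CP N :=
  Quotient.lift (fun p => hopf p.1) (by
    rintro ⟨z, a⟩ ⟨z', a'⟩ ⟨θ, h1, -⟩
    dsimp only at h1
    subst h1
    exact hopf_rotate θ z')

/-- The radial projection of a nonzero vector to the unit sphere. -/
def toSph {N : ℕ} (v : {v : Cn N // v ≠ 0}) : Sph N :=
  ⟨(‖(v : Cn N)‖ : ℂ)⁻¹ • (v : Cn N), by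
    have h : ‖(v : Cn N)‖ ≠ 0 := norm_ne_zero_iff.2 v.2
    simp [norm_smul, h]⟩

theorem toSph_smul {N : ℕ} {a b : {v : Cn N // v ≠ 0}} {t : ℂ}
    (h : (a : Cn N) = t • (b : Cn N)) : ∃ θ : ℝ, toSph a = rotate θ (toSph b) := by
  have hb : (‖(b : Cn N)‖ : ℂ) ≠ 0 := by exact_mod_cast norm_ne_zero_iff.2 b.2
  have ht : t ≠ 0 := by
    rintro rfl
    exact a.2 (by simpa using h)
  have ht' : (‖t‖ : ℂ) ≠ 0 := by exact_mod_cast norm_ne_zero_iff.2 ht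
  refine ⟨t.arg, Subtype.ext ?_⟩
  simp only [toSph, rotate, h, norm_smul, smul_smul]
  congr 1
  have e := Complex.norm_mul_exp_arg_mul_I t
  rw [mul_comm Complex.I]
  push_cast
  field_simp
  rw [← e]
  simp

/-- The section `s_ψ : π(z) ↦ [(z, ψ(z))]_k` of `ℒ^k` that corresponds to a function `ψ` on the
unit sphere with `ψ(e^{iθ} z) = e^{ikθ} ψ(z)`. -/
def sectionOf {N : ℕ} (k : ℕ) (ψ : Sph N → ℂ)
    (hψ : ∀ (θ : ℝ) (z : Sph N), ψ (rotate θ z) = Complex.exp (Complex.I * k * θ) * ψ z) :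
    CP N → Bundle N k :=
  Projectivization.lift (fun v => Bundle.mk k (toSph v) (ψ (toSph v))) (by
    intro a b t h
    obtain ⟨θ, hθ⟩ := toSph_smul h
    refine Quotient.sound ⟨θ, hθ, ?_⟩
    dsimp only
    rw [hθ, hψ, ← mul_assoc, ← Complex.exp_add]
    simp)

theorem sectionOf_hopf {N : ℕ} (k : ℕ) (ψ : Sph N → ℂ)
    (hψ : ∀ (θ : ℝ) (z : Sph N), ψ (rotate θ z) = Complex.exp (Complex.I * k * θ) * ψ z)
    (z : Sph N) : sectionOf k ψ hψ (hopf z) = Bundle.mk k z (ψ z) := by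
  have hz : ‖(z : Cn N)‖ = 1 := by simp
  have e : ∀ h : (z : Cn N) ≠ 0, toSph ⟨(z : Cn N), h⟩ = z := fun h =>
    Subtype.ext (by simp [toSph, hz])
  simp only [sectionOf, hopf, Projectivization.lift_mk, e]

/-- A reduced function is equivariant under the circle. -/
theorem reduction_rotate {N : ℕ} (k : ℕ) (ψ : Cn N → ℂ) (θ : ℝ) (z : Cn N) :
    reduction k ψ (Complex.exp (Complex.I * θ) • z) =
      Complex.exp (Complex.I * k * θ) * reduction k ψ z := by
  set f : ℝ → ℂ := fun t =>
    Complex.exp (-Complex.I * k * t) * ψ (Complex.exp (Complex.I * t) • z) with hf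
  have hper : Function.Periodic f (2 * Real.pi) := by
    intro t
    have e1 : Complex.exp (-Complex.I * k * ((t + 2 * Real.pi : ℝ) : ℂ)) =
        Complex.exp (-Complex.I * k * t) := by
      rw [Complex.exp_eq_exp_iff_exists_int]
      exact ⟨-k, by push_cast; ring⟩
    have e2 : Complex.exp (Complex.I * ((t + 2 * Real.pi : ℝ) : ℂ)) =
        Complex.exp (Complex.I * t) := by
      rw [Complex.exp_eq_exp_iff_exists_int]
      exact ⟨1, by push_cast; ring⟩
    simp only [hf, e1, e2]
  have key : ∀ t : ℝ, Complex.exp (-Complex.I * k * t) *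
      ψ (Complex.exp (Complex.I * t) • Complex.exp (Complex.I * θ) • z) =
      Complex.exp (Complex.I * k * θ) * f (t + θ) := by
    intro t
    simp only [hf, smul_smul, ← Complex.exp_add, ← mul_assoc]
    congr 2
    · push_cast; ring
    · congr 2; push_cast; ring
  unfold reduction
  simp_rw [key]
  rw [intervalIntegral.integral_const_mul, intervalIntegral.integral_comp_add_right]
  have := hper.intervalIntegral_add_eq θ 0
  rw [zero_add] at this
  rw [zero_add, add_comm (2 * Real.pi) θ, this]
  ring

/-- The reduced state as a section of `ℒ^k → ℂP^{N-1}`. -/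
def reducedSection {N : ℕ} (k : ℕ) (A : Matrix (Fin N) (Fin N) ℂ) (w : Cn N) :
    CP N → Bundle N k :=
  sectionOf k (fun z : Sph N => reducedState k A w z)
    (fun θ z => reduction_rotate k (coherent k A w) θ z)

/-! ### Micro-support, symbol and inner product -/

/-- The micro-support (semi-classical wave-front set) as `k → ∞` of a sequence of states whose
pointwise sizes are `ρ k`. A point is outside it when the sizes are `O(k^{-M})` for every `M`,
uniformly on one neighbourhood of the point. -/
def microSupport {X : Type*} [TopologicalSpace X] (ρ : ℕ → X → ℝ) : Set X :=
  {x | ¬ ∃ U ∈ 𝓝 x, ∀ M : ℕ, ∃ C : ℝ, ∀ᶠ k : ℕ in atTop,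
    ∀ y ∈ U, |ρ k y| ≤ C * ((k : ℝ) ^ M)⁻¹}

/-- The Hermitian orthogonal space `H_w = (ℂ w)^⊥`. -/
abbrev Horiz {N : ℕ} (w : Cn N) : Submodule ℂ (Cn N) := (Submodule.span ℂ {w})ᗮ

/-- The integrand `e^{Q_A(isw+η)/2} e^{-s²/2}`. -/
def symbolIntegrand {N : ℕ} (A : Matrix (Fin N) (Fin N) ℂ) (w η : Cn N) (s : ℝ) : ℂ :=
  Complex.exp (quad A ((Complex.I * s) • w + η) / 2) * Complex.exp (-(s : ℂ) ^ 2 / 2)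

/-- The symbol `σ_A(η) = (2π)⁻¹ e^{-|η|²/2} ∫ e^{Q_A(isw+η)/2} e^{-s²/2} ds`. -/
def symbol {N : ℕ} (A : Matrix (Fin N) (Fin N) ℂ) (w η : Cn N) : ℂ :=
  (1 / (2 * Real.pi) : ℂ) * Complex.exp (-(‖η‖ : ℂ) ^ 2 / 2) * ∫ s : ℝ, symbolIntegrand A w η s

/-- The inner product of `L²(S^{2N-1})`, for the surface measure of the unit sphere. -/
def sphereInner {N : ℕ} (f g : Sph N → ℂ) : ℂ :=
  ∫ z, f z * conj (g z) ∂(lebesgue (Cn N)).toSphere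

end ReducedGaussian

end

open ReducedGaussian

/-!
Since `A ∈ 𝒟_N`, one has `|Q_A(v)| ≤ r |v|²` with `r < 1`, so `|ψ_{A,w}|` is bounded by a Gaussian
of width `k^{-1/2}` about `w`. In the average over the circle at the point `c w + u / √k`, with
`u ⟂ w`, only angles `s / √k` with `s` bounded matter. There `k` times the exponent of the
integrand is its quadratic part `Q_A(i s w + u) / 2 - (s² + |u|²) / 2` up to `O(k^{-1/2})`, whence
the limit `σ_A`; replacing `(s, u)` by `(-s, -u)` changes the sign of the cubic terms, so that the
even part of the average is within `O(k^{-1})` of `σ_A`.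

For the inner products, `(θ, η) ↦ e^{iθ} √(1 - |η|²) w + η` carries `dθ dL(η)` on the product of
the circle and the unit ball of `H_w` to the surface measure of the sphere (the complex form of
Archimedes' hat-box theorem). Put `η = u / √k`: the integral of `σ_A σ̄_B` over the ball of radius
`√k` is approximated up to `O(k^{-1})` because the ball is symmetric in `u`.
-/

noncomputable section

namespace ReducedGaussian

open scoped ENNReal Pointwise

theorem norm_cexp_sub_cexp_le {m : ℝ} {a b : ℂ} (ha : a.re ≤ m) (hb : b.re ≤ m) :
    ‖Complex.exp b - Complex.exp a‖ ≤ Real.exp m * ‖b - a‖ :=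
  (convex_halfSpace_re_le m).norm_image_sub_le_of_norm_hasDerivWithin_le
    (fun z _ => (Complex.hasDerivAt_exp z).hasDerivWithinAt)
    (fun z hz => by rw [Complex.norm_exp]; exact Real.exp_le_exp.2 hz) ha hb

theorem norm_cexp_sub_cexp_sub_mul_le {m : ℝ} {a b : ℂ} (ha : a.re ≤ m) (hb : b.re ≤ m) :
    ‖Complex.exp b - Complex.exp a - Complex.exp a * (b - a)‖ ≤ Real.exp m * ‖b - a‖ ^ 2 := by
  have hseg : segment ℝ a b ⊆ {z : ℂ | z.re ≤ m} := (convex_halfSpace_re_le m).segment_subset ha hb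
  have hderiv (z : ℂ) : HasDerivAt (fun z => Complex.exp z - Complex.exp a * z)
      (Complex.exp z - Complex.exp a) z := by
    simpa using (Complex.hasDerivAt_exp z).fun_sub ((hasDerivAt_id z).const_mul (Complex.exp a))
  have hbound : ∀ z ∈ segment ℝ a b, ‖Complex.exp z - Complex.exp a‖ ≤ Real.exp m * ‖b - a‖ :=
    fun z hz => (norm_cexp_sub_cexp_le ha (hseg hz)).trans <| by
      gcongr; exact norm_sub_le_of_mem_segment hz
  calc ‖Complex.exp b - Complex.exp a - Complex.exp a * (b - a)‖
      = ‖Complex.exp b - Complex.exp a * b - (Complex.exp a - Complex.exp a * a)‖ := by ring_nf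
    _ ≤ Real.exp m * ‖b - a‖ * ‖b - a‖ :=
        (convex_segment a b).norm_image_sub_le_of_norm_hasDerivWithin_le
          (fun z _ => (hderiv z).hasDerivWithinAt) hbound
          (left_mem_segment ℝ a b) (right_mem_segment ℝ a b)
    _ = Real.exp m * ‖b - a‖ ^ 2 := by ring

theorem norm_cexp_add_cexp_sub_two_mul_le {m : ℝ} {a b₁ b₂ : ℂ} (ha : a.re ≤ m)
    (hb₁ : b₁.re ≤ m) (hb₂ : b₂.re ≤ m) :
    ‖Complex.exp b₁ + Complex.exp b₂ - 2 * Complex.exp a‖ ≤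
      Real.exp m * (‖b₁ - a‖ ^ 2 + ‖b₂ - a‖ ^ 2 + ‖b₁ + b₂ - 2 * a‖) :=
  calc ‖Complex.exp b₁ + Complex.exp b₂ - 2 * Complex.exp a‖
      = ‖(Complex.exp b₁ - Complex.exp a - Complex.exp a * (b₁ - a)) +
          (Complex.exp b₂ - Complex.exp a - Complex.exp a * (b₂ - a)) +
          Complex.exp a * (b₁ + b₂ - 2 * a)‖ := by ring_nf
    _ ≤ Real.exp m * ‖b₁ - a‖ ^ 2 + Real.exp m * ‖b₂ - a‖ ^ 2 +
          Real.exp m * ‖b₁ + b₂ - 2 * a‖ := by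
        refine norm_add₃_le.trans (add_le_add_three (norm_cexp_sub_cexp_sub_mul_le ha hb₁)
          (norm_cexp_sub_cexp_sub_mul_le ha hb₂) ?_)
        rw [norm_mul, Complex.norm_exp]
        gcongr
    _ = _ := by ring

theorem exists_pow_mul_exp_le {a : ℝ} (ha : 0 < a) (n : ℕ) : ∃ C : ℝ, 0 ≤ C ∧ ∀ x : ℝ, 0 ≤ x →
    (1 + x) ^ n * Real.exp (-(a * x ^ 2)) ≤ C * Real.exp (-(a / 2 * x ^ 2)) := by
  refine ⟨2 ^ n * (n.factorial * (2 / a) ^ n * Real.exp (a / 2)), by positivity, fun x hx => ?_⟩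
  have hpow : (1 + x ^ 2) ^ n ≤ n.factorial * (2 / a) ^ n * Real.exp (a / 2 * (1 + x ^ 2)) := by
    have h := Real.pow_div_factorial_le_exp (a / 2 * (1 + x ^ 2)) (by positivity) n
    rw [div_le_iff₀ (by positivity), mul_pow] at h
    calc (1 + x ^ 2) ^ n = (2 / a) ^ n * ((a / 2) ^ n * (1 + x ^ 2) ^ n) := by
          rw [← mul_assoc, ← mul_pow, div_mul_div_cancel₀ ha.ne']; simp
      _ ≤ (2 / a) ^ n * (Real.exp (a / 2 * (1 + x ^ 2)) * n.factorial) := by gcongr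
      _ = _ := by ring
  calc (1 + x) ^ n * Real.exp (-(a * x ^ 2))
      ≤ (2 * (1 + x ^ 2)) ^ n * Real.exp (-(a * x ^ 2)) := by
        gcongr; nlinarith [sq_nonneg (x - 1)]
    _ ≤ 2 ^ n * (n.factorial * (2 / a) ^ n * Real.exp (a / 2 * (1 + x ^ 2))) *
          Real.exp (-(a * x ^ 2)) := by rw [mul_pow]; gcongr
    _ = 2 ^ n * (n.factorial * (2 / a) ^ n * Real.exp (a / 2)) * Real.exp (-(a / 2 * x ^ 2)) := by
        rw [show a / 2 * (1 + x ^ 2) = a / 2 + a / 2 * x ^ 2 by ring, Real.exp_add,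
          show -(a * x ^ 2) = -(a / 2 * x ^ 2) + -(a / 2 * x ^ 2) by ring, Real.exp_add,
          Real.exp_neg (a / 2 * x ^ 2)]
        field_simp

section Quad

variable {N : ℕ} {A : Matrix (Fin N) (Fin N) ℂ}

/-- The complex bilinear form `(u, v) ↦ u A vᵀ` behind the quadratic form `quad A`. -/
def bilin {N : ℕ} (A : Matrix (Fin N) (Fin N) ℂ) : Cn N →ₗ[ℂ] Cn N →ₗ[ℂ] ℂ :=
  LinearMap.mk₂ ℂ (fun u v => ∑ i, ∑ j, u i * A i j * v j)
    (fun u u' v => by simp [add_mul, Finset.sum_add_distrib])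
    (fun a u v => by simp [Finset.mul_sum, mul_assoc])
    (fun u v v' => by simp [mul_add, Finset.sum_add_distrib])
    (fun a u v => by
      simp only [Finset.mul_sum, PiLp.smul_apply, smul_eq_mul]
      exact Finset.sum_congr rfl fun i _ => Finset.sum_congr rfl fun j _ => by ring)

theorem bilin_apply (u v : Cn N) : bilin A u v = ∑ i, ∑ j, u i * A i j * v j := rfl

theorem quad_eq_bilin (v : Cn N) : quad A v = bilin A v v := rfl

theorem bilin_comm (hA : A.IsSymm) (u v : Cn N) : bilin A u v = bilin A v u := by
  rw [bilin_apply, bilin_apply, Finset.sum_comm]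
  refine Finset.sum_congr rfl fun i _ => Finset.sum_congr rfl fun j _ => ?_
  rw [← hA.apply i j]; ring

theorem quad_add (hA : A.IsSymm) (u v : Cn N) :
    quad A (u + v) = quad A u + 2 * bilin A u v + quad A v := by
  simp only [quad_eq_bilin, map_add, LinearMap.add_apply]
  rw [bilin_comm hA v u]; ring

theorem quad_smul (a : ℂ) (v : Cn N) : quad A (a • v) = a ^ 2 * quad A v := by
  simp only [quad_eq_bilin, map_smul, LinearMap.smul_apply, smul_eq_mul]; ring

theorem quad_neg (v : Cn N) : quad A (-v) = quad A v := by
  simp [quad_eq_bilin]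

@[fun_prop]
theorem continuous_quad : Continuous (quad A) := by
  unfold quad; fun_prop

theorem exists_norm_bilin_le (A : Matrix (Fin N) (Fin N) ℂ) :
    ∃ K : ℝ, 0 ≤ K ∧ ∀ u v : Cn N, ‖bilin A u v‖ ≤ K * ‖u‖ * ‖v‖ := by
  refine ⟨∑ i, ∑ j, ‖A i j‖, by positivity, fun u v => ?_⟩
  simp only [bilin_apply, Finset.sum_mul]
  refine norm_sum_le_of_le _ fun i _ => norm_sum_le_of_le _ fun j _ => ?_
  rw [norm_mul, norm_mul, mul_comm ‖u i‖]
  gcongr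
  · exact PiLp.norm_apply_le u i
  · exact PiLp.norm_apply_le v j

theorem norm_mulVec_lt_of_mem_disk (hA : A ∈ disk N) {v : Cn N} (hv : v ≠ 0) :
    ‖(WithLp.toLp 2 (A *ᵥ v.ofLp) : Cn N)‖ < ‖v‖ := by
  have hpos := hA.2.dotProduct_mulVec_pos (x := v.ofLp) (by simpa using hv)
  have hsq (x : Cn N) : star x.ofLp ⬝ᵥ x.ofLp = (‖x‖ : ℂ) ^ 2 := by
    rw [dotProduct_comm, ← EuclideanSpace.inner_eq_star_dotProduct]
    exact inner_self_eq_norm_sq_to_K x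
  have hform : star v.ofLp ⬝ᵥ ((1 - Aᴴ * A) *ᵥ v.ofLp) =
      (‖v‖ ^ 2 - ‖(WithLp.toLp 2 (A *ᵥ v.ofLp) : Cn N)‖ ^ 2 : ℂ) := by
    rw [Matrix.sub_mulVec, dotProduct_sub, Matrix.one_mulVec, ← Matrix.mulVec_mulVec,
      Matrix.dotProduct_mulVec, Matrix.vecMul_conjTranspose, star_star, ← hsq, ← hsq]
  rw [hform] at hpos
  exact lt_of_pow_lt_pow_left₀ 2 (norm_nonneg v) (sub_pos.1 (by exact_mod_cast hpos))

theorem norm_quad_lt_of_mem_disk (hA : A ∈ disk N) {v : Cn N} (hv : v ≠ 0) :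
    ‖quad A v‖ < ‖v‖ ^ 2 := by
  set x : Cn N := WithLp.toLp 2 (star v.ofLp) with hx
  set y : Cn N := WithLp.toLp 2 (A *ᵥ v.ofLp) with hy
  have hquad : quad A v = inner ℂ x y := by
    rw [EuclideanSpace.inner_eq_star_dotProduct, dotProduct_comm]
    simp [hx, hy, quad, dotProduct, Matrix.mulVec, Finset.mul_sum, mul_assoc]
  have hxv : ‖x‖ = ‖v‖ := by simp [hx, EuclideanSpace.norm_eq]
  calc ‖quad A v‖ ≤ ‖v‖ * ‖y‖ := by rw [hquad, ← hxv]; exact norm_inner_le_norm x y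
    _ < ‖v‖ * ‖v‖ := by
        have := norm_pos_iff.2 hv
        gcongr
        exact norm_mulVec_lt_of_mem_disk hA hv
    _ = ‖v‖ ^ 2 := (sq _).symm

theorem exists_norm_quad_le (hA : A ∈ disk N) :
    ∃ r : ℝ, r < 1 ∧ ∀ v : Cn N, ‖quad A v‖ ≤ r * ‖v‖ ^ 2 := by
  obtain ⟨v₀, hv₀, hmax⟩ := (isCompact_closedBall (0 : Cn N) 1).exists_isMaxOn
    (Metric.nonempty_closedBall.2 zero_le_one) (f := fun v => ‖quad A v‖) (by fun_prop)
  refine ⟨‖quad A v₀‖, ?_, fun v => ?_⟩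
  · rcases eq_or_ne v₀ 0 with rfl | h
    · simp [quad]
    · exact (norm_quad_lt_of_mem_disk hA h).trans_le
        (pow_le_one₀ (norm_nonneg _) (by simpa using hv₀))
  · rcases eq_or_ne v 0 with rfl | hv
    · simp [quad]
    have : (‖v‖ : ℂ) ≠ 0 := by exact_mod_cast norm_ne_zero_iff.2 hv
    have hunit : ‖quad A ((‖v‖ : ℂ)⁻¹ • v)‖ ≤ ‖quad A v₀‖ :=
      hmax (by simp [norm_smul, hv])
    calc ‖quad A v‖ = ‖quad A ((‖v‖ : ℂ)⁻¹ • v)‖ * ‖v‖ ^ 2 := by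
          rw [quad_smul, norm_mul, norm_pow, norm_inv, Complex.norm_real, norm_norm]
          field_simp
      _ ≤ ‖quad A v₀‖ * ‖v‖ ^ 2 := by gcongr

end Quad

section Gaussian

variable {N : ℕ} {A : Matrix (Fin N) (Fin N) ℂ}

/-- The exponent of the Gaussian `e^{Q_A/2} e^{-‖·‖²/2}`. -/
def gaussianExponent (A : Matrix (Fin N) (Fin N) ℂ) (y : Cn N) : ℂ :=
  quad A y / 2 - (‖y‖ : ℂ) ^ 2 / 2

/-- The Gaussian `e^{Q_A/2} e^{-‖·‖²/2}` of the matrix `A`, which is the local model of the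
coherent states at their centre. -/
def gaussian (A : Matrix (Fin N) (Fin N) ℂ) (y : Cn N) : ℂ :=
  Complex.exp (gaussianExponent A y)

theorem gaussianExponent_neg (y : Cn N) : gaussianExponent A (-y) = gaussianExponent A y := by
  rw [gaussianExponent, quad_neg, norm_neg, gaussianExponent]

theorem gaussianExponent_smul (a : ℝ) (y : Cn N) :
    gaussianExponent A ((a : ℂ) • y) = a ^ 2 * gaussianExponent A y := by
  have h : (‖(a : ℂ) • y‖ : ℂ) ^ 2 = a ^ 2 * (‖y‖ : ℂ) ^ 2 := by
    rw [norm_smul, Complex.norm_real, ← Complex.ofReal_pow, mul_pow, Real.norm_eq_abs, sq_abs]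
    push_cast; rfl
  rw [gaussianExponent, quad_smul, h, gaussianExponent]
  ring

@[fun_prop]
theorem continuous_gaussian : Continuous (gaussian A) := by
  unfold gaussian gaussianExponent; fun_prop

theorem re_gaussianExponent_le {r : ℝ} (hr : ∀ v : Cn N, ‖quad A v‖ ≤ r * ‖v‖ ^ 2) (y : Cn N) :
    (gaussianExponent A y).re ≤ -((1 - r) / 2 * ‖y‖ ^ 2) := by
  have h := (Complex.re_le_norm _).trans (hr y)
  simp only [gaussianExponent, Complex.sub_re, Complex.div_ofNat_re, ← Complex.ofReal_pow,
    Complex.ofReal_re]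
  linarith

end Gaussian

section TangentVector

variable {N : ℕ} {w u : Cn N}

/-- The vector `i s w + u` tangent to the unit sphere at `w`, with coordinate `s` along the circle
orbit of `w` and horizontal part `u`. -/
def tangentVector (w u : Cn N) (s : ℝ) : Cn N := (Complex.I * s) • w + u

@[fun_prop]
theorem continuous_tangentVector (w : Cn N) :
    Continuous fun p : Cn N × ℝ => tangentVector w p.1 p.2 := by
  unfold tangentVector; fun_prop

theorem tangentVector_neg (s : ℝ) : tangentVector w (-u) (-s) = -tangentVector w u s := by
  rw [tangentVector, tangentVector, Complex.ofReal_neg]; module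

theorem tangentVector_smul (a s : ℝ) :
    tangentVector w ((a : ℂ) • u) (a * s) = (a : ℂ) • tangentVector w u s := by
  rw [tangentVector, tangentVector, Complex.ofReal_mul]; module

theorem norm_smul_add_smul_sq (hw : ‖w‖ = 1) (hu : inner ℂ w u = 0) (a b : ℂ) :
    ‖a • w + b • u‖ ^ 2 = ‖a‖ ^ 2 + ‖b‖ ^ 2 * ‖u‖ ^ 2 := by
  have h : inner ℂ (a • w) (b • u) = 0 := by rw [inner_smul_left, inner_smul_right, hu]; simp
  have := norm_add_sq_eq_norm_sq_add_norm_sq_of_inner_eq_zero _ _ h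
  rw [sq, this, norm_smul, norm_smul, hw]; ring

theorem norm_smul_add_sq (hw : ‖w‖ = 1) (hu : inner ℂ w u = 0) (a : ℂ) :
    ‖a • w + u‖ ^ 2 = ‖a‖ ^ 2 + ‖u‖ ^ 2 := by
  simpa using norm_smul_add_smul_sq hw hu a 1

theorem norm_tangentVector_sq (hw : ‖w‖ = 1) (hu : inner ℂ w u = 0) (s : ℝ) :
    ‖tangentVector w u s‖ ^ 2 = s ^ 2 + ‖u‖ ^ 2 := by
  rw [tangentVector, norm_smul_add_sq hw hu]; simp

theorem abs_le_norm_tangentVector (hw : ‖w‖ = 1) (hu : inner ℂ w u = 0) (s : ℝ) :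
    |s| ≤ ‖tangentVector w u s‖ :=
  abs_le_of_sq_le_sq' (by rw [norm_tangentVector_sq hw hu]; simp) (norm_nonneg _) |> abs_le.2

theorem norm_le_norm_tangentVector (hw : ‖w‖ = 1) (hu : inner ℂ w u = 0) (s : ℝ) :
    ‖u‖ ≤ ‖tangentVector w u s‖ :=
  le_of_sq_le_sq (by rw [norm_tangentVector_sq hw hu]; nlinarith [sq_nonneg s]) (norm_nonneg _)

end TangentVector

section Coherent

variable {N : ℕ} {A : Matrix (Fin N) (Fin N) ℂ}

/-- The exponent of the coherent state per unit of `k`: `ψ_{A,w} = e^{k · exponent A w}`. -/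
def exponent (A : Matrix (Fin N) (Fin N) ℂ) (w z : Cn N) : ℂ :=
  quad A (z - w) / 2 + inner ℂ w z - (‖w‖ : ℂ) ^ 2 / 2 - (‖z‖ : ℂ) ^ 2 / 2

/-- The phase of the circle average that defines the reduced state: its integrand at the angle
`t` is `e^{k · phase A w t z}`. -/
def phase (A : Matrix (Fin N) (Fin N) ℂ) (w : Cn N) (t : ℝ) (z : Cn N) : ℂ :=
  exponent A w (Complex.exp (Complex.I * t) • z) - Complex.I * t

theorem coherent_eq_cexp (k : ℕ) (w z : Cn N) :
    coherent k A w z = Complex.exp (k * exponent A w z) := by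
  rw [coherent, exponent, ← Complex.exp_add, ← Complex.exp_add, ← Complex.exp_add, PiLp.inner_apply]
  simp only [RCLike.inner_apply]
  congr 1
  ring

theorem cexp_mul_coherent (k : ℕ) (w z : Cn N) (t : ℝ) :
    Complex.exp (-Complex.I * k * t) * coherent k A w (Complex.exp (Complex.I * t) • z) =
      Complex.exp (k * phase A w t z) := by
  rw [coherent_eq_cexp, ← Complex.exp_add, phase]
  congr 1
  ring

theorem re_exponent_le {r : ℝ} (hr : ∀ v : Cn N, ‖quad A v‖ ≤ r * ‖v‖ ^ 2) (w z : Cn N) :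
    (exponent A w z).re ≤ -((1 - r) / 2 * ‖z - w‖ ^ 2) := by
  have hquad := (Complex.re_le_norm _).trans (hr (z - w))
  have hpolar := norm_sub_sq (𝕜 := ℂ) z w
  rw [inner_re_symm] at hpolar
  simp only [RCLike.re_to_complex] at hpolar
  simp only [exponent, Complex.add_re, Complex.sub_re, Complex.div_ofNat_re, ← Complex.ofReal_pow,
    Complex.ofReal_re]
  linarith

theorem norm_cexp_natCast_mul_le {z : ℂ} {x : ℝ} (h : z.re ≤ x) (k : ℕ) :
    ‖Complex.exp (k * z)‖ ≤ Real.exp (k * x) := by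
  rw [Complex.norm_exp, ← Complex.ofReal_natCast, Complex.re_ofReal_mul]
  gcongr

theorem norm_coherent_le {r : ℝ} (hr : ∀ v : Cn N, ‖quad A v‖ ≤ r * ‖v‖ ^ 2) (k : ℕ) (w z : Cn N) :
    ‖coherent k A w z‖ ≤ Real.exp (k * -((1 - r) / 2 * ‖z - w‖ ^ 2)) := by
  rw [coherent_eq_cexp]
  exact norm_cexp_natCast_mul_le (re_exponent_le hr w z) k

@[fun_prop]
theorem continuous_coherent (k : ℕ) (w : Cn N) : Continuous (coherent k A w) := by
  unfold coherent; fun_prop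

theorem continuous_reducedState (k : ℕ) (w : Cn N) : Continuous (reducedState k A w) := by
  unfold reducedState reduction
  refine continuous_const.mul ?_
  apply intervalIntegral.continuous_parametric_intervalIntegral_of_continuous'
  simp only [Function.uncurry_def]
  fun_prop

theorem continuous_phase (w z : Cn N) : Continuous fun t : ℝ => phase A w t z := by
  unfold phase exponent; fun_prop

theorem reduction_eq_integral_neg_pi_pi (k : ℕ) (ψ : Cn N → ℂ) (z : Cn N) :
    reduction k ψ z = (1 / (2 * Real.pi) : ℂ) * ∫ t in (-Real.pi)..Real.pi,
      Complex.exp (-Complex.I * k * t) * ψ (Complex.exp (Complex.I * t) • z) := by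
  have hper : Function.Periodic (fun t : ℝ =>
      Complex.exp (-Complex.I * k * t) * ψ (Complex.exp (Complex.I * t) • z)) (2 * Real.pi) := by
    intro t
    have hexp (n : ℤ) : Complex.exp (Complex.I * n * ((t + 2 * Real.pi : ℝ) : ℂ)) =
        Complex.exp (Complex.I * n * t) :=
      Complex.exp_eq_exp_iff_exists_int.2 ⟨n, by push_cast; ring⟩
    have h1 := hexp (-k)
    have h2 := hexp 1
    push_cast at h1 h2 ⊢
    simp only [mul_neg, mul_one, ← neg_mul] at h1 h2
    rw [h1, h2]
  have := hper.intervalIntegral_add_eq 0 (-Real.pi)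
  rw [zero_add, show -Real.pi + 2 * Real.pi = Real.pi by ring] at this
  rw [reduction, this]

/-- The integrand of the reduced state in the rescaled angle `s = √k t`, extended by zero. -/
def wave (k : ℕ) (A : Matrix (Fin N) (Fin N) ℂ) (w z : Cn N) : ℝ → ℂ :=
  (Set.Icc (-(Real.pi * √k)) (Real.pi * √k)).indicator fun s =>
    Complex.exp (k * phase A w (s / √(k : ℝ)) z)

theorem integrable_wave (k : ℕ) (w z : Cn N) : Integrable (wave k A w z) := by
  have := continuous_phase (A := A) w z
  exact (integrable_indicator_iff measurableSet_Icc).2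
    (ContinuousOn.integrableOn_Icc (by fun_prop))

theorem sqrt_mul_reducedState {k : ℕ} (hk : k ≠ 0) (w z : Cn N) :
    (√(k : ℝ) : ℂ) * reducedState k A w z = (1 / (2 * Real.pi) : ℂ) * ∫ s, wave k A w z s := by
  have hk0 : √(k : ℝ) ≠ 0 := by positivity
  have hscale := intervalIntegral.integral_comp_div (a := -(Real.pi * √k)) (b := Real.pi * √k)
    (fun t : ℝ => Complex.exp (k * phase A w t z)) hk0
  rw [neg_div, mul_div_cancel_right₀ _ hk0, Complex.real_smul] at hscale
  rw [reducedState, reduction_eq_integral_neg_pi_pi, mul_left_comm]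
  simp only [cexp_mul_coherent]
  rw [← hscale, wave, integral_indicator measurableSet_Icc, integral_Icc_eq_integral_Ioc,
    intervalIntegral.integral_of_le (by linarith [show 0 ≤ Real.pi * √(k : ℝ) by positivity])]

end Coherent

section Phase

variable {N : ℕ} {w v : Cn N} {c t : ℝ}

theorem sq_div_ten_le_add_sub_mul_cos (hc : 0 ≤ c) (ht : |t| ≤ Real.pi) :
    t ^ 2 / 10 ≤ c ^ 2 + 1 - 2 * c * Real.cos t := by
  have hpi : Real.pi ^ 2 ≤ 10 := by nlinarith [Real.pi_lt_d2, Real.pi_pos]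
  have ht2 : t ^ 2 ≤ Real.pi ^ 2 := sq_le_sq' (abs_le.1 ht).1 (abs_le.1 ht).2
  rcases le_total 0 (Real.cos t) with h | h
  · have hpi' : 1 / 10 ≤ 2 / Real.pi ^ 2 := by
      rw [div_le_div_iff₀ (by norm_num) (by positivity)]
      linarith
    have hcos : Real.cos t ≤ 1 - 1 / 10 * t ^ 2 := by
      nlinarith [Real.cos_le_one_sub_mul_cos_sq ht, mul_le_mul_of_nonneg_right hpi' (sq_nonneg t)]
    nlinarith [sq_nonneg (c - Real.cos t), Real.cos_le_one t]
  · nlinarith [mul_nonpos_of_nonneg_of_nonpos hc h, sq_nonneg c]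

theorem norm_sq_le_norm_rotate_sub_sq (hw : ‖w‖ = 1) (hv : inner ℂ w v = 0)
    (hc : 0 ≤ c) (ht : |t| ≤ Real.pi) :
    ‖tangentVector w v t‖ ^ 2 / 10 ≤
      ‖Complex.exp (Complex.I * t) • ((c : ℂ) • w + v) - w‖ ^ 2 := by
  set e := Complex.exp (Complex.I * t) with he
  have hsplit : e • ((c : ℂ) • w + v) - w = (c * e - 1) • w + e • v := by module
  have hnorm : ‖(c : ℂ) * e - 1‖ ^ 2 = c ^ 2 + 1 - 2 * c * Real.cos t := by
    have : (c : ℂ) * e - 1 =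
        ((c * Real.cos t - 1 : ℝ) : ℂ) + ((c * Real.sin t : ℝ) : ℂ) * Complex.I := by
      rw [he, mul_comm Complex.I, Complex.exp_mul_I]; push_cast; ring
    rw [this, Complex.sq_norm, Complex.normSq_add_mul_I]
    linear_combination c ^ 2 * Real.sin_sq_add_cos_sq t
  rw [hsplit, norm_smul_add_smul_sq hw hv, norm_tangentVector_sq hw hv, hnorm, he,
    Complex.norm_exp_I_mul_ofReal]
  nlinarith [sq_div_ten_le_add_sub_mul_cos hc ht, sq_nonneg ‖v‖]

theorem re_phase_le {A : Matrix (Fin N) (Fin N) ℂ} {r : ℝ} (hr1 : r < 1)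
    (hr : ∀ v : Cn N, ‖quad A v‖ ≤ r * ‖v‖ ^ 2) (hw : ‖w‖ = 1) (hv : inner ℂ w v = 0)
    (hc : 0 ≤ c) (ht : |t| ≤ Real.pi) :
    (phase A w t ((c : ℂ) • w + v)).re ≤ -((1 - r) / 20 * ‖tangentVector w v t‖ ^ 2) := by
  have hexp := re_exponent_le hr w (Complex.exp (Complex.I * t) • ((c : ℂ) • w + v))
  have hdist := norm_sq_le_norm_rotate_sub_sq hw hv hc ht
  have hre : (Complex.I * (t : ℂ)).re = 0 := by simp
  rw [phase, Complex.sub_re, hre, sub_zero]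
  nlinarith

end Phase

/-- The remainder of the Taylor polynomial with `n` terms of `e^{it}` at `t = 0`. -/
def cexpRemainder (n : ℕ) (t : ℝ) : ℂ :=
  Complex.exp (Complex.I * t) - ∑ m ∈ Finset.range n, (Complex.I * t) ^ m / (m.factorial : ℂ)

theorem norm_cexpRemainder_le {t : ℝ} (ht : |t| ≤ Real.pi) (n : ℕ) :
    ‖cexpRemainder n t‖ ≤ Real.exp Real.pi * |t| ^ n := by
  have hnorm : ‖Complex.I * (t : ℂ)‖ = |t| := by simp
  have h := Complex.norm_exp_sub_sum_le_norm_mul_exp (Complex.I * t) n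
  rw [hnorm] at h
  exact h.trans <| by rw [mul_comm]; gcongr

theorem cexpRemainder_one (t : ℝ) : cexpRemainder 1 t = Complex.exp (Complex.I * t) - 1 := by
  simp [cexpRemainder]

theorem cexpRemainder_two (t : ℝ) :
    cexpRemainder 2 t = Complex.exp (Complex.I * t) - 1 - Complex.I * t := by
  simp [cexpRemainder, Finset.sum_range_succ, sub_sub]

theorem cexpRemainder_three (t : ℝ) :
    cexpRemainder 3 t = Complex.exp (Complex.I * t) - 1 - Complex.I * t + t ^ 2 / 2 := by
  simp only [cexpRemainder, Finset.sum_range_succ, Finset.sum_range_zero, Nat.factorial]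
  push_cast
  linear_combination -(t : ℂ) ^ 2 / 2 * Complex.I_sq

theorem cexpRemainder_four (t : ℝ) : cexpRemainder 4 t =
    Complex.exp (Complex.I * t) - 1 - Complex.I * t + t ^ 2 / 2 + Complex.I * t ^ 3 / 6 := by
  simp only [cexpRemainder, Finset.sum_range_succ, Finset.sum_range_zero, Nat.factorial]
  push_cast
  linear_combination (-(t : ℂ) ^ 2 / 2 - Complex.I * t ^ 3 / 6) * Complex.I_sq

section PhaseExpansion

variable {N : ℕ} {A : Matrix (Fin N) (Fin N) ℂ} {w v : Cn N} {c t R : ℝ}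

/-- The displacement `e^{it} (c w + v) - w` minus its linear part `i t w + v`. -/
def drift (w v : Cn N) (c t : ℝ) : Cn N :=
  (c * Complex.exp (Complex.I * t) - 1 - Complex.I * t) • w +
    (Complex.exp (Complex.I * t) - 1) • v

/-- The part of the phase at `c w + v` that depends neither on `A` nor on `v`, without its
quadratic term `-t² / 2`. -/
def phaseDefect (c t : ℝ) : ℂ :=
  c * Complex.exp (Complex.I * t) - 1 / 2 - c ^ 2 / 2 - Complex.I * t + t ^ 2 / 2

theorem phase_eq (hA : A.IsSymm) (hw : ‖w‖ = 1) (hv : inner ℂ w v = 0) :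
    phase A w t ((c : ℂ) • w + v) = gaussianExponent A (tangentVector w v t) +
      (bilin A (tangentVector w v t) (drift w v c t) + quad A (drift w v c t) / 2 +
        phaseDefect c t) := by
  set e := Complex.exp (Complex.I * t) with he
  have hsub : e • ((c : ℂ) • w + v) - w = tangentVector w v t + drift w v c t := by
    rw [tangentVector, drift, ← he]; module
  have hinner : inner ℂ w (e • ((c : ℂ) • w + v)) = e * c := by
    rw [inner_smul_right, inner_add_right, inner_smul_right, hv, inner_self_eq_norm_sq_to_K, hw]
    simp
  have hz : (‖e • ((c : ℂ) • w + v)‖ : ℂ) ^ 2 = c ^ 2 + (‖v‖ : ℂ) ^ 2 := by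
    rw [norm_smul, he, Complex.norm_exp_I_mul_ofReal, one_mul, ← Complex.ofReal_pow,
      norm_smul_add_sq hw hv, Complex.norm_real, Real.norm_eq_abs, sq_abs]
    push_cast; rfl
  have hy : (‖tangentVector w v t‖ : ℂ) ^ 2 = t ^ 2 + (‖v‖ : ℂ) ^ 2 := by
    exact_mod_cast congrArg Complex.ofReal (norm_tangentVector_sq hw hv t)
  rw [phase, exponent, gaussianExponent, hsub, quad_add hA, hinner, hz, hy, hw, phaseDefect, ← he]
  push_cast
  ring

/-- The displacement from `w` of `e^{it} (c w + v)`, with `0 ≤ c ≤ 1`, is of size at most `R`.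
The quantity `1 - c` is of second order, as it is on the sphere and inside it. -/
structure IsNear (c t : ℝ) (v : Cn N) (R : ℝ) : Prop where
  nonneg : 0 ≤ c
  le_one : c ≤ 1
  one_sub_le : 1 - c ≤ R ^ 2
  abs_le : |t| ≤ R
  abs_le_pi : |t| ≤ Real.pi
  norm_le : ‖v‖ ≤ R

namespace IsNear

theorem neg (h : IsNear c t v R) : IsNear c (-t) (-v) R where
  __ := h
  abs_le := by simpa using h.abs_le
  abs_le_pi := by simpa using h.abs_le_pi
  norm_le := by simpa using h.norm_le

theorem radius_nonneg (h : IsNear c t v R) : 0 ≤ R := (abs_nonneg t).trans h.abs_le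

theorem norm_one_sub_le_sq (h : IsNear c t v R) : ‖(1 - c : ℂ)‖ ≤ R ^ 2 := by
  have := h.one_sub_le
  rwa [← Complex.ofReal_one, ← Complex.ofReal_sub, Complex.norm_real,
    Real.norm_of_nonneg (sub_nonneg.2 h.le_one)]

theorem norm_one_sub_le (h : IsNear c t v R) : ‖(1 - c : ℂ)‖ ≤ R := by
  rw [← Complex.ofReal_one, ← Complex.ofReal_sub, Complex.norm_real,
    Real.norm_of_nonneg (sub_nonneg.2 h.le_one)]
  refine le_of_sq_le_sq ?_ h.radius_nonneg
  nlinarith [h.nonneg, h.le_one, h.one_sub_le]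

theorem norm_I_mul_le (h : IsNear c t v R) : ‖Complex.I * (t : ℂ)‖ ≤ R := by
  simpa using h.abs_le

theorem norm_cexpRemainder_le (h : IsNear c t v R) (n : ℕ) :
    ‖cexpRemainder n t‖ ≤ Real.exp Real.pi * R ^ n :=
  (ReducedGaussian.norm_cexpRemainder_le h.abs_le_pi n).trans <| by gcongr; exact h.abs_le

theorem norm_mul_cexpRemainder_le (h : IsNear c t v R) (n : ℕ) :
    ‖(c : ℂ) * cexpRemainder n t‖ ≤ Real.exp Real.pi * R ^ n := by
  rw [norm_mul, Complex.norm_real, Real.norm_of_nonneg h.nonneg]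
  exact (mul_le_of_le_one_left (norm_nonneg _) h.le_one).trans (h.norm_cexpRemainder_le n)

end IsNear

theorem norm_smul_add_smul_le {a b : ℂ} {x y : ℝ} (hw : ‖w‖ = 1) (ha : ‖a‖ ≤ x) (hb : ‖b‖ ≤ y)
    (hv : ‖v‖ ≤ R) : ‖a • w + b • v‖ ≤ x + y * R := by
  refine norm_add_le_of_le (by rwa [norm_smul, hw, mul_one]) ?_
  rw [norm_smul]
  exact mul_le_mul hb hv (norm_nonneg v) ((norm_nonneg b).trans hb)

theorem norm_drift_le (hw : ‖w‖ = 1) (h : IsNear c t v R) :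
    ‖drift w v c t‖ ≤ 2 * (Real.exp Real.pi + 1) * R ^ 2 := by
  have heq : drift w v c t = (c * cexpRemainder 2 t - (1 - c) - (1 - c) * (Complex.I * t)) • w +
      cexpRemainder 1 t • v := by
    rw [drift, cexpRemainder_one, cexpRemainder_two]
    module
  have hcoef : ‖c * cexpRemainder 2 t - (1 - c) - (1 - c) * (Complex.I * t)‖ ≤
      Real.exp Real.pi * R ^ 2 + R ^ 2 + R * R :=
    norm_sub_le_of_le (norm_sub_le_of_le (h.norm_mul_cexpRemainder_le 2) h.norm_one_sub_le_sq)
      (norm_mul_le_of_le h.norm_one_sub_le h.norm_I_mul_le)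
  rw [heq]
  exact (norm_smul_add_smul_le hw hcoef (h.norm_cexpRemainder_le 1) h.norm_le).trans_eq (by ring)

theorem norm_phaseDefect_le (h : IsNear c t v R) :
    ‖phaseDefect c t‖ ≤ (Real.exp Real.pi + 2) * R ^ 3 := by
  have heq : phaseDefect c t = c * cexpRemainder 3 t -
      1 / 2 * ((1 - c) * (1 - c) + (1 - c) * (Complex.I * t * (Complex.I * t))) -
        (1 - c) * (Complex.I * t) := by
    rw [phaseDefect, cexpRemainder_three]
    linear_combination (1 - c) * t ^ 2 / 2 * Complex.I_sq
  have hhalf : ‖(1 / 2 : ℂ)‖ ≤ 1 / 2 := by simp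
  rw [heq]
  exact (norm_sub_le_of_le (norm_sub_le_of_le (h.norm_mul_cexpRemainder_le 3)
    (norm_mul_le_of_le hhalf (norm_add_le_of_le
      (norm_mul_le_of_le h.norm_one_sub_le_sq h.norm_one_sub_le)
      (norm_mul_le_of_le h.norm_one_sub_le
        (norm_mul_le_of_le h.norm_I_mul_le h.norm_I_mul_le)))))
    (norm_mul_le_of_le h.norm_one_sub_le_sq h.norm_I_mul_le)).trans_eq (by ring)

theorem norm_drift_sub_drift_neg_le (hw : ‖w‖ = 1) (h : IsNear c t v R) :
    ‖drift w v c t - drift w (-v) c (-t)‖ ≤ (4 * Real.exp Real.pi + 2) * R ^ 3 := by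
  have heq : drift w v c t - drift w (-v) c (-t) =
      (c * cexpRemainder 3 t - c * cexpRemainder 3 (-t) -
        ((1 - c) * (Complex.I * t) + (1 - c) * (Complex.I * t))) • w +
      (cexpRemainder 2 t + cexpRemainder 2 (-t)) • v := by
    simp only [drift, cexpRemainder_two, cexpRemainder_three, Complex.ofReal_neg]
    module
  have hcoef := norm_sub_le_of_le
    (norm_sub_le_of_le (h.norm_mul_cexpRemainder_le 3) (h.neg.norm_mul_cexpRemainder_le 3))
    (norm_add_le_of_le (norm_mul_le_of_le h.norm_one_sub_le_sq h.norm_I_mul_le)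
      (norm_mul_le_of_le h.norm_one_sub_le_sq h.norm_I_mul_le))
  have hcoef' := norm_add_le_of_le (h.norm_cexpRemainder_le 2) (h.neg.norm_cexpRemainder_le 2)
  rw [heq]
  exact (norm_smul_add_smul_le hw hcoef hcoef' h.norm_le).trans_eq (by ring)

theorem norm_phaseDefect_add_neg_le (h : IsNear c t v R) :
    ‖phaseDefect c t + phaseDefect c (-t)‖ ≤ 2 * (Real.exp Real.pi + 1) * R ^ 4 := by
  have heq : phaseDefect c t + phaseDefect c (-t) = c * cexpRemainder 4 t +
      c * cexpRemainder 4 (-t) - (1 - c) * (1 - c) -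
        (1 - c) * (Complex.I * t * (Complex.I * t)) := by
    simp only [phaseDefect, cexpRemainder_four, Complex.ofReal_neg]
    linear_combination (1 - c) * t ^ 2 * Complex.I_sq
  rw [heq]
  exact (norm_sub_le_of_le (norm_sub_le_of_le
    (norm_add_le_of_le (h.norm_mul_cexpRemainder_le 4) (h.neg.norm_mul_cexpRemainder_le 4))
    (norm_mul_le_of_le h.norm_one_sub_le_sq h.norm_one_sub_le_sq))
    (norm_mul_le_of_le h.norm_one_sub_le_sq (norm_mul_le_of_le h.norm_I_mul_le h.norm_I_mul_le))
    ).trans_eq (by ring)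

theorem exists_norm_phase_sub_le (hA : A.IsSymm) (hw : ‖w‖ = 1) :
    ∃ K : ℝ, 0 ≤ K ∧ ∀ {c t : ℝ} {v : Cn N}, inner ℂ w v = 0 →
      IsNear c t v ‖tangentVector w v t‖ →
      ‖phase A w t ((c : ℂ) • w + v) - gaussianExponent A (tangentVector w v t)‖ ≤
        K * ‖tangentVector w v t‖ ^ 3 * (1 + ‖tangentVector w v t‖) := by
  obtain ⟨L, hL0, hL⟩ := exists_norm_bilin_le A
  set D := 2 * (Real.exp Real.pi + 1)
  refine ⟨L * D + 1 / 2 * (L * D * D) + (Real.exp Real.pi + 2), by positivity,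
    fun {c t v} hv h => ?_⟩
  set R := ‖tangentVector w v t‖
  set ρ := drift w v c t
  have hρR : ‖ρ‖ ≤ D * R ^ 2 := norm_drift_le hw h
  have hbilin : ‖bilin A (tangentVector w v t) ρ‖ ≤ L * R * (D * R ^ 2) :=
    (hL _ _).trans (by gcongr)
  have hquad : ‖quad A ρ / 2‖ ≤ L * (D * R ^ 2) * (D * R ^ 2) / 2 := by
    rw [norm_div, Complex.norm_ofNat]
    gcongr
    exact (hL ρ ρ).trans (by gcongr)
  rw [phase_eq hA hw hv, add_sub_cancel_left]
  calc _ ≤ L * R * (D * R ^ 2) + L * (D * R ^ 2) * (D * R ^ 2) / 2 +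
          (Real.exp Real.pi + 2) * R ^ 3 :=
        norm_add_le_of_le (norm_add_le_of_le hbilin hquad) (norm_phaseDefect_le h)
    _ = (L * D + (Real.exp Real.pi + 2)) * R ^ 3 + 1 / 2 * (L * D * D) * (R ^ 3 * R) := by ring
    _ ≤ (L * D + 1 / 2 * (L * D * D) + (Real.exp Real.pi + 2)) * R ^ 3 * (1 + R) := by
        have : 0 ≤ (L * D + (Real.exp Real.pi + 2)) * (R ^ 3 * R) +
            1 / 2 * (L * D * D) * R ^ 3 := by positivity
        linarith

theorem exists_norm_phase_add_phase_neg_sub_le (hA : A.IsSymm) (hw : ‖w‖ = 1) :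
    ∃ K : ℝ, 0 ≤ K ∧ ∀ {c t : ℝ} {v : Cn N}, inner ℂ w v = 0 →
      IsNear c t v ‖tangentVector w v t‖ →
      ‖phase A w t ((c : ℂ) • w + v) + phase A w (-t) ((c : ℂ) • w + -v) -
          2 * gaussianExponent A (tangentVector w v t)‖ ≤ K * ‖tangentVector w v t‖ ^ 4 := by
  obtain ⟨L, hL0, hL⟩ := exists_norm_bilin_le A
  set D := 2 * (Real.exp Real.pi + 1)
  refine ⟨L * (4 * Real.exp Real.pi + 2) + L * D * D + D, by positivity, fun {c t v} hv h => ?_⟩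
  set y := tangentVector w v t
  set ρ := drift w v c t
  set ρ' := drift w (-v) c (-t)
  have hodd : ‖bilin A y (ρ - ρ')‖ ≤ L * ‖y‖ * ((4 * Real.exp Real.pi + 2) * ‖y‖ ^ 3) :=
    (hL _ _).trans (by gcongr; exact norm_drift_sub_drift_neg_le hw h)
  have hquad {x : Cn N} (hx : ‖x‖ ≤ D * ‖y‖ ^ 2) :
      ‖quad A x / 2‖ ≤ L * (D * ‖y‖ ^ 2) * (D * ‖y‖ ^ 2) / 2 := by
    rw [norm_div, Complex.norm_ofNat]
    gcongr
    exact (hL x x).trans (by gcongr)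
  have heq : phase A w t ((c : ℂ) • w + v) + phase A w (-t) ((c : ℂ) • w + -v) -
      2 * gaussianExponent A y = bilin A y (ρ - ρ') + (quad A ρ / 2 + quad A ρ' / 2) +
        (phaseDefect c t + phaseDefect c (-t)) := by
    rw [phase_eq hA hw hv, phase_eq hA hw (by simpa using hv), tangentVector_neg,
      gaussianExponent_neg, map_neg, map_sub, LinearMap.neg_apply]
    ring
  rw [heq]
  exact (norm_add_le_of_le (norm_add_le_of_le hodd (norm_add_le_of_le
    (hquad (norm_drift_le hw h)) (hquad (norm_drift_le hw h.neg))))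
    (norm_phaseDefect_add_neg_le h)).trans_eq (by ring)

end PhaseExpansion

section Wave

variable {N k : ℕ} {A : Matrix (Fin N) (Fin N) ℂ} {w u : Cn N} {c : ℝ}

/-- The point with coordinate `c` along `w` and horizontal part `u / √k`. The reduced states are
evaluated at such points, with `c = 1` in the scaling limit and `c = √(1 - ‖u‖² / k)` on the
sphere. -/
def rescaledPoint (k : ℕ) (w : Cn N) (c : ℝ) (u : Cn N) : Cn N :=
  (c : ℂ) • w + ((√(k : ℝ))⁻¹ : ℂ) • u

/-- The point `rescaledPoint k w c u` lies on or outside the unit sphere and its coordinate `c`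
along the unit vector `w` is in `[0, 1]`. -/
structure IsAdmissible (k : ℕ) (w : Cn N) (c : ℝ) (u : Cn N) : Prop where
  ne_zero : k ≠ 0
  norm_eq_one : ‖w‖ = 1
  inner_eq_zero : inner ℂ w u = 0
  nonneg : 0 ≤ c
  le_one : c ≤ 1
  one_le : 1 ≤ c ^ 2 + ((√(k : ℝ))⁻¹ * ‖u‖) ^ 2

namespace IsAdmissible

theorem neg (h : IsAdmissible k w c u) : IsAdmissible k w c (-u) where
  __ := h
  inner_eq_zero := by simpa using h.inner_eq_zero
  one_le := by simpa using h.one_le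

theorem sqrt_pos (h : IsAdmissible k w c u) : 0 < √(k : ℝ) := by
  have := h.ne_zero; positivity

theorem inv_sqrt_le_one (h : IsAdmissible k w c u) : (√(k : ℝ))⁻¹ ≤ 1 :=
  inv_le_one_of_one_le₀ (Real.one_le_sqrt.2 (by exact_mod_cast Nat.one_le_iff_ne_zero.2 h.ne_zero))

theorem natCast_mul_inv_sqrt_sq (h : IsAdmissible k w c u) : (k : ℝ) * (√(k : ℝ))⁻¹ ^ 2 = 1 := by
  have := h.ne_zero
  rw [inv_pow, Real.sq_sqrt (by positivity), mul_inv_cancel₀ (by positivity)]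

theorem inner_smul_eq_zero (h : IsAdmissible k w c u) :
    inner ℂ w (((√(k : ℝ))⁻¹ : ℂ) • u) = 0 := by
  rw [inner_smul_right, h.inner_eq_zero, mul_zero]

theorem isNear (h : IsAdmissible k w c u) {s : ℝ} (hs : |s / √(k : ℝ)| ≤ Real.pi) :
    IsNear c (s / √(k : ℝ)) (((√(k : ℝ))⁻¹ : ℂ) • u)
      ‖tangentVector w (((√(k : ℝ))⁻¹ : ℂ) • u) (s / √(k : ℝ))‖ where
  nonneg := h.nonneg
  le_one := h.le_one
  one_sub_le := by
    have hnorm : ‖((√(k : ℝ))⁻¹ : ℂ) • u‖ = (√(k : ℝ))⁻¹ * ‖u‖ := by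
      rw [norm_smul, norm_inv, Complex.norm_real, Real.norm_of_nonneg h.sqrt_pos.le]
    rw [norm_tangentVector_sq h.norm_eq_one h.inner_smul_eq_zero, hnorm]
    nlinarith [h.one_le, h.nonneg, h.le_one, sq_nonneg (s / √(k : ℝ))]
  abs_le := abs_le_norm_tangentVector h.norm_eq_one h.inner_smul_eq_zero _
  abs_le_pi := hs
  norm_le := norm_le_norm_tangentVector h.norm_eq_one h.inner_smul_eq_zero _

end IsAdmissible

theorem tangentVector_rescaled (k : ℕ) (w u : Cn N) (s : ℝ) :
    tangentVector w (((√(k : ℝ))⁻¹ : ℂ) • u) (s / √(k : ℝ)) =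
      (((√(k : ℝ))⁻¹ : ℝ) : ℂ) • tangentVector w u s := by
  simpa [div_eq_inv_mul] using tangentVector_smul (w := w) (u := u) (√(k : ℝ))⁻¹ s

theorem norm_tangentVector_rescaled (k : ℕ) (w u : Cn N) (s : ℝ) :
    ‖tangentVector w (((√(k : ℝ))⁻¹ : ℂ) • u) (s / √(k : ℝ))‖ =
      (√(k : ℝ))⁻¹ * ‖tangentVector w u s‖ := by
  rw [tangentVector_rescaled, norm_smul, Complex.norm_real, Real.norm_of_nonneg (by positivity)]

theorem natCast_mul_gaussianExponent_rescaled (h : IsAdmissible k w c u) (s : ℝ) :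
    k * gaussianExponent A (tangentVector w (((√(k : ℝ))⁻¹ : ℂ) • u) (s / √(k : ℝ))) =
      gaussianExponent A (tangentVector w u s) := by
  have hk : (k : ℂ) * (((√(k : ℝ))⁻¹ : ℝ) : ℂ) ^ 2 = 1 := by
    exact_mod_cast congrArg Complex.ofReal h.natCast_mul_inv_sqrt_sq
  rw [tangentVector_rescaled, gaussianExponent_smul, ← mul_assoc, hk, one_mul]

theorem exists_norm_rescaled_phase_sub_le (hA : A.IsSymm) (hw : ‖w‖ = 1) :
    ∃ K : ℝ, 0 ≤ K ∧ ∀ {k : ℕ} {c : ℝ} {u : Cn N} {s : ℝ}, IsAdmissible k w c u →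
      |s / √(k : ℝ)| ≤ Real.pi →
      ‖k * phase A w (s / √(k : ℝ)) (rescaledPoint k w c u) -
        gaussianExponent A (tangentVector w u s)‖ ≤
        K * (√(k : ℝ))⁻¹ * (1 + ‖tangentVector w u s‖) ^ 4 := by
  obtain ⟨K, hK0, hK⟩ := exists_norm_phase_sub_le hA hw
  refine ⟨K, hK0, fun {k c u s} h hs => ?_⟩
  have hphase := hK h.inner_smul_eq_zero (h.isNear hs)
  rw [norm_tangentVector_rescaled] at hphase
  set x := ‖tangentVector w u s‖
  set ε := (√(k : ℝ))⁻¹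
  have : 0 ≤ ε := by positivity
  have hε1 : ε ≤ 1 := h.inv_sqrt_le_one
  have : 0 ≤ x := norm_nonneg _
  rw [← natCast_mul_gaussianExponent_rescaled h, ← mul_sub, norm_mul, Complex.norm_natCast]
  calc _ ≤ (k : ℝ) * (K * (ε * x) ^ 3 * (1 + ε * x)) := by gcongr; exact hphase
    _ = k * ε ^ 2 * (K * ε * (x ^ 3 * (1 + ε * x))) := by ring
    _ = K * ε * (x ^ 3 * (1 + ε * x)) := by rw [h.natCast_mul_inv_sqrt_sq, one_mul]
    _ ≤ K * ε * ((1 + x) ^ 3 * (1 + 1 * x)) := by gcongr; linarith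
    _ = K * ε * (1 + x) ^ 4 := by ring

theorem exists_norm_rescaled_phase_add_phase_neg_sub_le (hA : A.IsSymm) (hw : ‖w‖ = 1) :
    ∃ K : ℝ, 0 ≤ K ∧ ∀ {k : ℕ} {c : ℝ} {u : Cn N} {s : ℝ}, IsAdmissible k w c u →
      |s / √(k : ℝ)| ≤ Real.pi →
      ‖k * phase A w (s / √(k : ℝ)) (rescaledPoint k w c u) +
          k * phase A w (-s / √(k : ℝ)) (rescaledPoint k w c (-u)) -
        2 * gaussianExponent A (tangentVector w u s)‖ ≤
        K * (√(k : ℝ))⁻¹ ^ 2 * ‖tangentVector w u s‖ ^ 4 := by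
  obtain ⟨K, hK0, hK⟩ := exists_norm_phase_add_phase_neg_sub_le hA hw
  refine ⟨K, hK0, fun {k c u s} h hs => ?_⟩
  have hphase := hK h.inner_smul_eq_zero (h.isNear hs)
  rw [norm_tangentVector_rescaled] at hphase
  rw [← natCast_mul_gaussianExponent_rescaled h, ← mul_add, mul_left_comm, ← mul_sub, norm_mul,
    Complex.norm_natCast, rescaledPoint, rescaledPoint, smul_neg, neg_div]
  calc _ ≤ (k : ℝ) * (K * ((√(k : ℝ))⁻¹ * ‖tangentVector w u s‖) ^ 4) := by gcongr
    _ = k * (√(k : ℝ))⁻¹ ^ 2 * (K * (√(k : ℝ))⁻¹ ^ 2 * ‖tangentVector w u s‖ ^ 4) := by ring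
    _ = K * (√(k : ℝ))⁻¹ ^ 2 * ‖tangentVector w u s‖ ^ 4 := by
        rw [h.natCast_mul_inv_sqrt_sq, one_mul]

theorem abs_div_sqrt_le_pi_iff (hk : k ≠ 0) (s : ℝ) :
    |s / √(k : ℝ)| ≤ Real.pi ↔ s ∈ Set.Icc (-(Real.pi * √(k : ℝ))) (Real.pi * √k) := by
  have : 0 < √(k : ℝ) := by positivity
  rw [abs_div, abs_of_pos this, div_le_iff₀ this, abs_le, Set.mem_Icc]

theorem wave_of_abs_le (hk : k ≠ 0) {s : ℝ} (hs : |s / √(k : ℝ)| ≤ Real.pi) (z : Cn N) :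
    wave k A w z s = Complex.exp (k * phase A w (s / √(k : ℝ)) z) :=
  Set.indicator_of_mem ((abs_div_sqrt_le_pi_iff hk s).1 hs) _

theorem wave_of_lt_abs (hk : k ≠ 0) {s : ℝ} (hs : Real.pi < |s / √(k : ℝ)|) (z : Cn N) :
    wave k A w z s = 0 :=
  Set.indicator_of_notMem (fun h => hs.not_ge ((abs_div_sqrt_le_pi_iff hk s).2 h)) _

theorem IsAdmissible.one_le_of_pi_lt (h : IsAdmissible k w c u) {s : ℝ}
    (hs : Real.pi < |s / √(k : ℝ)|) : 1 ≤ (√(k : ℝ))⁻¹ * (1 + ‖tangentVector w u s‖) :=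
  calc (1 : ℝ) ≤ |s / √(k : ℝ)| := by linarith [Real.pi_gt_three]
    _ = (√(k : ℝ))⁻¹ * |s| := by rw [abs_div, abs_of_pos h.sqrt_pos, div_eq_inv_mul]
    _ ≤ (√(k : ℝ))⁻¹ * (1 + ‖tangentVector w u s‖) := by
        gcongr
        linarith [abs_le_norm_tangentVector h.norm_eq_one h.inner_eq_zero s]

theorem IsAdmissible.re_natCast_mul_phase_le (h : IsAdmissible k w c u) {r : ℝ} (hr1 : r < 1)
    (hr : ∀ v : Cn N, ‖quad A v‖ ≤ r * ‖v‖ ^ 2) {s : ℝ} (hs : |s / √(k : ℝ)| ≤ Real.pi) :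
    (k * phase A w (s / √(k : ℝ)) (rescaledPoint k w c u)).re ≤
      -((1 - r) / 20 * ‖tangentVector w u s‖ ^ 2) := by
  have hphase := re_phase_le hr1 hr h.norm_eq_one h.inner_smul_eq_zero h.nonneg hs
  rw [norm_tangentVector_rescaled] at hphase
  rw [← Complex.ofReal_natCast, Complex.re_ofReal_mul]
  calc _ ≤ (k : ℝ) * -((1 - r) / 20 * ((√(k : ℝ))⁻¹ * ‖tangentVector w u s‖) ^ 2) := by
        gcongr; exact hphase
    _ = k * (√(k : ℝ))⁻¹ ^ 2 * -((1 - r) / 20 * ‖tangentVector w u s‖ ^ 2) := by ring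
    _ = _ := by rw [h.natCast_mul_inv_sqrt_sq, one_mul]

end Wave

section WaveEstimates

variable {N k : ℕ} {A : Matrix (Fin N) (Fin N) ℂ} {w u : Cn N} {c : ℝ}

theorem exists_norm_wave_sub_gaussian_le (hA : A.IsSymm) (hw : ‖w‖ = 1) {r : ℝ}
    (hr1 : r < 1) (hr : ∀ v : Cn N, ‖quad A v‖ ≤ r * ‖v‖ ^ 2) :
    ∃ C : ℝ, 0 ≤ C ∧ ∀ {k : ℕ} {c : ℝ} {u : Cn N} (s : ℝ), IsAdmissible k w c u →
      ‖wave k A w (rescaledPoint k w c u) s - gaussian A (tangentVector w u s)‖ ≤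
        C * (√(k : ℝ))⁻¹ * Real.exp (-((1 - r) / 40 * ‖tangentVector w u s‖ ^ 2)) := by
  obtain ⟨K, hK0, hK⟩ := exists_norm_rescaled_phase_sub_le hA hw
  obtain ⟨C, hC0, hC⟩ := exists_pow_mul_exp_le (a := (1 - r) / 20) (by linarith) 4
  rw [show (1 - r) / 20 / 2 = (1 - r) / 40 by ring] at hC
  refine ⟨(K + 1) * C, by positivity, fun {k c u} s h => ?_⟩
  set y := tangentVector w u s
  set m := -((1 - r) / 20 * ‖y‖ ^ 2) with hm
  have hexp : (gaussianExponent A y).re ≤ m :=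
    (re_gaussianExponent_le hr y).trans (by nlinarith [sq_nonneg ‖y‖])
  have hdiff : ‖wave k A w (rescaledPoint k w c u) s - gaussian A y‖ ≤
      (K + 1) * (√(k : ℝ))⁻¹ * ((1 + ‖y‖) ^ 4 * Real.exp m) := by
    rcases le_or_gt |s / √(k : ℝ)| Real.pi with hs | hs
    · rw [wave_of_abs_le h.ne_zero hs, gaussian]
      calc _ ≤ Real.exp m * (K * (√(k : ℝ))⁻¹ * (1 + ‖y‖) ^ 4) :=
            (norm_cexp_sub_cexp_le hexp (h.re_natCast_mul_phase_le hr1 hr hs)).trans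
              (by gcongr; exact hK h hs)
        _ = K * (√(k : ℝ))⁻¹ * ((1 + ‖y‖) ^ 4 * Real.exp m) := by ring
        _ ≤ (K + 1) * (√(k : ℝ))⁻¹ * ((1 + ‖y‖) ^ 4 * Real.exp m) := by gcongr; linarith
    · rw [wave_of_lt_abs h.ne_zero hs, zero_sub, norm_neg, gaussian, Complex.norm_exp]
      calc Real.exp (gaussianExponent A y).re ≤ 1 * Real.exp m := by rw [one_mul]; gcongr
        _ ≤ (√(k : ℝ))⁻¹ * (1 + ‖y‖) * Real.exp m := by gcongr; exact h.one_le_of_pi_lt hs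
        _ ≤ (√(k : ℝ))⁻¹ * (1 + ‖y‖) ^ 4 * Real.exp m := by
            gcongr
            exact le_self_pow₀ (by linarith [norm_nonneg y]) (by norm_num)
        _ = 1 * (√(k : ℝ))⁻¹ * ((1 + ‖y‖) ^ 4 * Real.exp m) := by ring
        _ ≤ (K + 1) * (√(k : ℝ))⁻¹ * ((1 + ‖y‖) ^ 4 * Real.exp m) := by gcongr; linarith
  calc _ ≤ (K + 1) * (√(k : ℝ))⁻¹ * (C * Real.exp (-((1 - r) / 40 * ‖y‖ ^ 2))) :=
        hdiff.trans (mul_le_mul_of_nonneg_left (hC _ (norm_nonneg y)) (by positivity))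
    _ = _ := by ring

theorem exists_norm_wave_add_wave_neg_sub_gaussian_le_of_abs_le (hA : A.IsSymm) (hw : ‖w‖ = 1)
    {r : ℝ} (hr1 : r < 1) (hr : ∀ v : Cn N, ‖quad A v‖ ≤ r * ‖v‖ ^ 2) :
    ∃ C : ℝ, 0 ≤ C ∧ ∀ {k : ℕ} {c : ℝ} {u : Cn N} {s : ℝ}, IsAdmissible k w c u →
      |s / √(k : ℝ)| ≤ Real.pi →
      ‖wave k A w (rescaledPoint k w c u) s + wave k A w (rescaledPoint k w c (-u)) (-s) -
          2 * gaussian A (tangentVector w u s)‖ ≤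
        C * (√(k : ℝ))⁻¹ ^ 2 * ((1 + ‖tangentVector w u s‖) ^ 8 *
          Real.exp (-((1 - r) / 20 * ‖tangentVector w u s‖ ^ 2))) := by
  obtain ⟨K, -, hK⟩ := exists_norm_rescaled_phase_sub_le hA hw
  obtain ⟨L, hL0, hL⟩ := exists_norm_rescaled_phase_add_phase_neg_sub_le hA hw
  refine ⟨2 * K ^ 2 + L, by positivity, fun {k c u s} h hs => ?_⟩
  have hneg : tangentVector w (-u) (-s) = -tangentVector w u s := tangentVector_neg s
  set y := tangentVector w u s
  set ε := (√(k : ℝ))⁻¹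
  have hs' : |-s / √(k : ℝ)| ≤ Real.pi := by rwa [neg_div, abs_neg]
  have hre := h.neg.re_natCast_mul_phase_le hr1 hr hs'
  have hsub := hK h.neg hs'
  have hsum := hL h hs
  rw [hneg, norm_neg] at hre
  rw [hneg, norm_neg, gaussianExponent_neg] at hsub
  have hexp : (gaussianExponent A y).re ≤ -((1 - r) / 20 * ‖y‖ ^ 2) :=
    (re_gaussianExponent_le hr y).trans (by nlinarith [sq_nonneg ‖y‖])
  have hpow : ‖y‖ ^ 4 ≤ (1 + ‖y‖) ^ 8 :=
    (pow_le_pow_left₀ (norm_nonneg y) (by linarith) 4).trans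
      (pow_le_pow_right₀ (by linarith [norm_nonneg y]) (by norm_num))
  rw [wave_of_abs_le h.ne_zero hs, wave_of_abs_le h.ne_zero hs', gaussian]
  calc _ ≤ Real.exp (-((1 - r) / 20 * ‖y‖ ^ 2)) * ((K * ε * (1 + ‖y‖) ^ 4) ^ 2 +
          (K * ε * (1 + ‖y‖) ^ 4) ^ 2 + L * ε ^ 2 * (1 + ‖y‖) ^ 8) := by
        refine (norm_cexp_add_cexp_sub_two_mul_le hexp
          (h.re_natCast_mul_phase_le hr1 hr hs) hre).trans ?_
        refine mul_le_mul_of_nonneg_left (add_le_add_three ?_ ?_ ?_) (Real.exp_nonneg _)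
        · exact pow_le_pow_left₀ (norm_nonneg _) (hK h hs) 2
        · exact pow_le_pow_left₀ (norm_nonneg _) hsub 2
        · exact hsum.trans (mul_le_mul_of_nonneg_left hpow (by positivity))
    _ = _ := by ring

theorem norm_wave_add_wave_neg_sub_gaussian_le_of_lt_abs {r : ℝ} (hr1 : r < 1)
    (hr : ∀ v : Cn N, ‖quad A v‖ ≤ r * ‖v‖ ^ 2) (h : IsAdmissible k w c u) {s : ℝ}
    (hs : Real.pi < |s / √(k : ℝ)|) :
    ‖wave k A w (rescaledPoint k w c u) s + wave k A w (rescaledPoint k w c (-u)) (-s) -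
        2 * gaussian A (tangentVector w u s)‖ ≤
      2 * (√(k : ℝ))⁻¹ ^ 2 * ((1 + ‖tangentVector w u s‖) ^ 8 *
        Real.exp (-((1 - r) / 20 * ‖tangentVector w u s‖ ^ 2))) := by
  have hs' : Real.pi < |-s / √(k : ℝ)| := by rwa [neg_div, abs_neg]
  set y := tangentVector w u s
  have hone : 1 ≤ ((√(k : ℝ))⁻¹ * (1 + ‖y‖)) ^ 2 := one_le_pow₀ (h.one_le_of_pi_lt hs)
  rw [wave_of_lt_abs h.ne_zero hs, wave_of_lt_abs h.ne_zero hs', zero_add, zero_sub, norm_neg,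
    norm_mul, Complex.norm_ofNat, gaussian, Complex.norm_exp]
  calc 2 * Real.exp (gaussianExponent A y).re
      ≤ 2 * (1 * Real.exp (-((1 - r) / 20 * ‖y‖ ^ 2))) := by
        rw [one_mul]
        gcongr
        exact (re_gaussianExponent_le hr y).trans (by nlinarith [sq_nonneg ‖y‖])
    _ ≤ 2 * (((√(k : ℝ))⁻¹ * (1 + ‖y‖)) ^ 2 * Real.exp (-((1 - r) / 20 * ‖y‖ ^ 2))) := by gcongr
    _ = 2 * (√(k : ℝ))⁻¹ ^ 2 * ((1 + ‖y‖) ^ 2 * Real.exp (-((1 - r) / 20 * ‖y‖ ^ 2))) := by ring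
    _ ≤ _ := by
        gcongr
        · linarith [norm_nonneg y]
        · norm_num

theorem exists_norm_wave_add_wave_neg_sub_gaussian_le (hA : A.IsSymm) (hw : ‖w‖ = 1) {r : ℝ}
    (hr1 : r < 1) (hr : ∀ v : Cn N, ‖quad A v‖ ≤ r * ‖v‖ ^ 2) :
    ∃ C : ℝ, 0 ≤ C ∧ ∀ {k : ℕ} {c : ℝ} {u : Cn N} (s : ℝ), IsAdmissible k w c u →
      ‖wave k A w (rescaledPoint k w c u) s + wave k A w (rescaledPoint k w c (-u)) (-s) -
          2 * gaussian A (tangentVector w u s)‖ ≤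
        C * (√(k : ℝ))⁻¹ ^ 2 * Real.exp (-((1 - r) / 40 * ‖tangentVector w u s‖ ^ 2)) := by
  obtain ⟨K, hK0, hK⟩ := exists_norm_wave_add_wave_neg_sub_gaussian_le_of_abs_le hA hw hr1 hr
  obtain ⟨C, hC0, hC⟩ := exists_pow_mul_exp_le (a := (1 - r) / 20) (by linarith) 8
  rw [show (1 - r) / 20 / 2 = (1 - r) / 40 by ring] at hC
  refine ⟨(K + 2) * C, by positivity, fun {k c u} s h => ?_⟩
  have hdiff : ‖wave k A w (rescaledPoint k w c u) s +
      wave k A w (rescaledPoint k w c (-u)) (-s) - 2 * gaussian A (tangentVector w u s)‖ ≤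
      (K + 2) * (√(k : ℝ))⁻¹ ^ 2 * ((1 + ‖tangentVector w u s‖) ^ 8 *
        Real.exp (-((1 - r) / 20 * ‖tangentVector w u s‖ ^ 2))) := by
    rcases le_or_gt |s / √(k : ℝ)| Real.pi with hs | hs
    · exact (hK h hs).trans (by gcongr; linarith)
    · exact (norm_wave_add_wave_neg_sub_gaussian_le_of_lt_abs hr1 hr h hs).trans
        (by gcongr; linarith)
  calc _ ≤ (K + 2) * (√(k : ℝ))⁻¹ ^ 2 *
          (C * Real.exp (-((1 - r) / 40 * ‖tangentVector w u s‖ ^ 2))) :=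
        hdiff.trans (mul_le_mul_of_nonneg_left (hC _ (norm_nonneg _)) (by positivity))
    _ = _ := by ring

end WaveEstimates

section Symbol

variable {N : ℕ} {A : Matrix (Fin N) (Fin N) ℂ} {w u : Cn N}

theorem exp_neg_mul_norm_tangentVector_sq (hw : ‖w‖ = 1) (hu : inner ℂ w u = 0) (b s : ℝ) :
    Real.exp (-(b * ‖tangentVector w u s‖ ^ 2)) =
      Real.exp (-b * s ^ 2) * Real.exp (-(b * ‖u‖ ^ 2)) := by
  rw [norm_tangentVector_sq hw hu, ← Real.exp_add]
  congr 1
  ring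

theorem integrable_exp_neg_mul_norm_tangentVector_sq {b : ℝ} (hb : 0 < b) (hw : ‖w‖ = 1)
    (hu : inner ℂ w u = 0) :
    Integrable fun s : ℝ => Real.exp (-(b * ‖tangentVector w u s‖ ^ 2)) := by
  simp_rw [exp_neg_mul_norm_tangentVector_sq hw hu]
  exact (integrable_exp_neg_mul_sq hb).mul_const _

theorem norm_integral_div_two_pi_le {f : ℝ → ℂ} {b C : ℝ} (hb : 0 < b) (hw : ‖w‖ = 1)
    (hu : inner ℂ w u = 0)
    (hf : ∀ s, ‖f s‖ ≤ C * Real.exp (-(b * ‖tangentVector w u s‖ ^ 2))) :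
    ‖(1 / (2 * Real.pi) : ℂ) * ∫ s, f s‖ ≤ C * √(Real.pi / b) * Real.exp (-(b * ‖u‖ ^ 2)) := by
  have hpi : ‖(1 / (2 * Real.pi) : ℂ)‖ ≤ 1 := by
    rw [norm_div, norm_mul, norm_one, Complex.norm_real, Real.norm_of_nonneg Real.pi_pos.le,
      Complex.norm_ofNat, div_le_one (by positivity)]
    linarith [Real.pi_gt_three]
  rw [norm_mul]
  calc _ ≤ ‖∫ s, f s‖ := mul_le_of_le_one_left (norm_nonneg _) hpi
    _ ≤ ∫ s, C * Real.exp (-(b * ‖tangentVector w u s‖ ^ 2)) :=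
        norm_integral_le_of_norm_le
          ((integrable_exp_neg_mul_norm_tangentVector_sq hb hw hu).const_mul C) (.of_forall hf)
    _ = _ := by
        simp_rw [exp_neg_mul_norm_tangentVector_sq hw hu]
        rw [integral_const_mul, integral_mul_const, integral_gaussian, mul_assoc]

theorem norm_gaussian_le {r : ℝ} (hr1 : r < 1) (hr : ∀ v : Cn N, ‖quad A v‖ ≤ r * ‖v‖ ^ 2)
    (y : Cn N) : ‖gaussian A y‖ ≤ Real.exp (-((1 - r) / 40 * ‖y‖ ^ 2)) := by
  rw [gaussian, Complex.norm_exp]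
  exact Real.exp_le_exp.2 ((re_gaussianExponent_le hr y).trans (by nlinarith [sq_nonneg ‖y‖]))

theorem integrable_gaussian_tangentVector {r : ℝ} (hr1 : r < 1)
    (hr : ∀ v : Cn N, ‖quad A v‖ ≤ r * ‖v‖ ^ 2) (hw : ‖w‖ = 1) (hu : inner ℂ w u = 0) :
    Integrable fun s : ℝ => gaussian A (tangentVector w u s) :=
  (integrable_exp_neg_mul_norm_tangentVector_sq (by linarith) hw hu).mono'
    (by fun_prop) (.of_forall fun s => norm_gaussian_le hr1 hr _)

theorem gaussian_tangentVector (hw : ‖w‖ = 1) (hu : inner ℂ w u = 0) (s : ℝ) :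
    gaussian A (tangentVector w u s) =
      Complex.exp (-(‖u‖ : ℂ) ^ 2 / 2) * symbolIntegrand A w u s := by
  have hnorm : (‖tangentVector w u s‖ : ℂ) ^ 2 = s ^ 2 + ‖u‖ ^ 2 := by
    exact_mod_cast congrArg Complex.ofReal (norm_tangentVector_sq hw hu s)
  rw [gaussian, gaussianExponent, hnorm, symbolIntegrand, tangentVector, ← Complex.exp_add,
    ← Complex.exp_add]
  congr 1
  ring

theorem integrable_symbolIntegrand (hA : A ∈ disk N) (hw : ‖w‖ = 1) (hu : inner ℂ w u = 0) :
    Integrable (symbolIntegrand A w u) := by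
  obtain ⟨r, hr1, hr⟩ := exists_norm_quad_le hA
  have := integrable_gaussian_tangentVector hr1 hr hw hu
  simp only [gaussian_tangentVector hw hu] at this
  exact (integrable_const_mul_iff (isUnit_iff_ne_zero.2 (Complex.exp_ne_zero _)) _).1 this

theorem symbol_eq_integral_gaussian (hw : ‖w‖ = 1) (hu : inner ℂ w u = 0) :
    symbol A w u = (1 / (2 * Real.pi) : ℂ) * ∫ s : ℝ, gaussian A (tangentVector w u s) := by
  simp_rw [gaussian_tangentVector hw hu]
  rw [symbol, integral_const_mul, mul_assoc]

theorem exists_norm_symbol_le (hw : ‖w‖ = 1) {r : ℝ} (hr1 : r < 1)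
    (hr : ∀ v : Cn N, ‖quad A v‖ ≤ r * ‖v‖ ^ 2) :
    ∃ C : ℝ, 0 ≤ C ∧ ∀ u : Cn N, inner ℂ w u = 0 →
      ‖symbol A w u‖ ≤ C * Real.exp (-((1 - r) / 40 * ‖u‖ ^ 2)) := by
  refine ⟨1 * √(Real.pi / ((1 - r) / 40)), by positivity, fun u hu => ?_⟩
  rw [symbol_eq_integral_gaussian hw hu]
  refine norm_integral_div_two_pi_le (by linarith) hw hu fun s => ?_
  rw [one_mul]
  exact norm_gaussian_le hr1 hr _

theorem exists_norm_sqrt_mul_reducedState_sub_symbol_le (hA : A.IsSymm) (hw : ‖w‖ = 1) {r : ℝ}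
    (hr1 : r < 1) (hr : ∀ v : Cn N, ‖quad A v‖ ≤ r * ‖v‖ ^ 2) :
    ∃ C : ℝ, 0 ≤ C ∧ ∀ {k : ℕ} {c : ℝ} {u : Cn N}, IsAdmissible k w c u →
      ‖√(k : ℝ) * reducedState k A w (rescaledPoint k w c u) - symbol A w u‖ ≤
        C * (√(k : ℝ))⁻¹ * Real.exp (-((1 - r) / 40 * ‖u‖ ^ 2)) := by
  obtain ⟨C, hC0, hC⟩ := exists_norm_wave_sub_gaussian_le hA hw hr1 hr
  refine ⟨C * √(Real.pi / ((1 - r) / 40)), by positivity, fun {k c u} h => ?_⟩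
  have hu := h.inner_eq_zero
  rw [sqrt_mul_reducedState h.ne_zero, symbol_eq_integral_gaussian hw hu, ← mul_sub,
    ← integral_sub (integrable_wave k w _) (integrable_gaussian_tangentVector hr1 hr hw hu)]
  exact (norm_integral_div_two_pi_le (by linarith) hw hu fun s => hC s h).trans_eq (by ring)

theorem exists_norm_sqrt_mul_reducedState_add_neg_sub_symbol_le (hA : A.IsSymm) (hw : ‖w‖ = 1)
    {r : ℝ} (hr1 : r < 1) (hr : ∀ v : Cn N, ‖quad A v‖ ≤ r * ‖v‖ ^ 2) :
    ∃ C : ℝ, 0 ≤ C ∧ ∀ {k : ℕ} {c : ℝ} {u : Cn N}, IsAdmissible k w c u →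
      ‖√(k : ℝ) * reducedState k A w (rescaledPoint k w c u) +
          √(k : ℝ) * reducedState k A w (rescaledPoint k w c (-u)) - 2 * symbol A w u‖ ≤
        C * (√(k : ℝ))⁻¹ ^ 2 * Real.exp (-((1 - r) / 40 * ‖u‖ ^ 2)) := by
  obtain ⟨C, hC0, hC⟩ := exists_norm_wave_add_wave_neg_sub_gaussian_le hA hw hr1 hr
  refine ⟨C * √(Real.pi / ((1 - r) / 40)), by positivity, fun {k c u} h => ?_⟩
  have hu := h.inner_eq_zero
  have hpos := integrable_wave (A := A) k w (rescaledPoint k w c u)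
  have hneg := (integrable_wave (A := A) k w (rescaledPoint k w c (-u))).comp_neg
  have hsum : Integrable fun s => wave k A w (rescaledPoint k w c u) s +
      wave k A w (rescaledPoint k w c (-u)) (-s) := hpos.add hneg
  rw [sqrt_mul_reducedState h.ne_zero, sqrt_mul_reducedState h.ne_zero,
    ← integral_neg_eq_self (wave k A w (rescaledPoint k w c (-u))),
    symbol_eq_integral_gaussian hw hu, mul_left_comm, ← mul_add, ← mul_sub, ← integral_const_mul,
    ← integral_add hpos hneg, ← integral_sub hsum
      ((integrable_gaussian_tangentVector hr1 hr hw hu).const_mul 2)]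
  exact (norm_integral_div_two_pi_le (by linarith) hw hu fun s => hC s h).trans_eq (by ring)

theorem tendsto_sqrt_mul_reducedState (hA : A ∈ disk N) (hw : ‖w‖ = 1) (hu : inner ℂ w u = 0) :
    Tendsto (fun k : ℕ => (√(k : ℝ) : ℂ) *
      reducedState k A w (w + ((√(k : ℝ))⁻¹ : ℂ) • u)) atTop (𝓝 (symbol A w u)) := by
  obtain ⟨r, hr1, hr⟩ := exists_norm_quad_le hA
  obtain ⟨C, -, hC⟩ := exists_norm_sqrt_mul_reducedState_sub_symbol_le hA.1 hw hr1 hr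
  have hlim : Tendsto (fun k : ℕ => C * (√(k : ℝ))⁻¹ * Real.exp (-((1 - r) / 40 * ‖u‖ ^ 2)))
      atTop (𝓝 0) := by
    have hinv : Tendsto (fun k : ℕ => (√(k : ℝ))⁻¹) atTop (𝓝 0) :=
      tendsto_inv_atTop_zero.comp (Real.tendsto_sqrt_atTop.comp tendsto_natCast_atTop_atTop)
    simpa only [mul_zero, zero_mul] using (hinv.const_mul C).mul_const _
  refine tendsto_iff_norm_sub_tendsto_zero.2 (squeeze_zero' (.of_forall fun k => norm_nonneg _)
    ?_ hlim)
  filter_upwards [eventually_ne_atTop 0] with k hk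
  have h : IsAdmissible k w 1 u :=
    ⟨hk, hw, hu, zero_le_one, le_rfl, by nlinarith [sq_nonneg ((√(k : ℝ))⁻¹ * ‖u‖)]⟩
  simpa [rescaledPoint] using hC h

end Symbol

section Lebesgue

variable (H : Type*) [NormedAddCommGroup H] [InnerProductSpace ℂ H] [FiniteDimensional ℂ H]
  [MeasurableSpace H] [BorelSpace H]

instance : (lebesgue H).IsAddHaarMeasure := by
  let _ : InnerProductSpace ℝ H := InnerProductSpace.rclikeToReal ℂ H
  unfold lebesgue
  infer_instance

theorem integrable_exp_neg_mul_norm_sq {b : ℝ} (hb : 0 < b) :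
    Integrable (fun v : H => Real.exp (-(b * ‖v‖ ^ 2))) (lebesgue H) := by
  let _ : InnerProductSpace ℝ H := InnerProductSpace.rclikeToReal ℂ H
  have := (GaussianFourier.integrable_cexp_neg_mul_sq_norm_add (V := H) (b := b)
    (by simpa using hb) 0 0).norm
  refine this.congr (.of_forall fun v => ?_)
  simp [Complex.norm_exp, ← Complex.ofReal_pow]

end Lebesgue

section ClosedForm

variable {N : ℕ} {A : Matrix (Fin N) (Fin N) ℂ} {w : Cn N}

theorem re_quad_add_one_pos (hA : A ∈ disk N) (hw : ‖w‖ = 1) : 0 < (quad A w + 1).re := by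
  have hlt := norm_quad_lt_of_mem_disk hA (norm_ne_zero_iff.1 (hw ▸ one_ne_zero))
  have hre := (abs_le.1 (Complex.abs_re_le_norm (quad A w))).1
  rw [hw, one_pow] at hlt
  rw [Complex.add_re, Complex.one_re]
  linarith

theorem ofReal_div_cpow_half {x : ℝ} (hx : 0 < x) {z : ℂ} (hz : 0 < z.re) :
    ((x : ℂ) / z) ^ (1 / 2 : ℂ) = √x * (1 / z ^ (1 / 2 : ℂ)) := by
  have harg : z.arg ≠ Real.pi := fun h => (Complex.arg_eq_pi_iff.1 h).1.not_gt hz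
  have hz0 : z⁻¹ ≠ 0 := inv_ne_zero (by rintro rfl; simp at hz)
  have hx0 : (x : ℂ) ≠ 0 := Complex.ofReal_ne_zero.2 hx.ne'
  rw [one_div (z ^ _), ← Complex.inv_cpow _ _ harg, div_eq_mul_inv,
    Complex.cpow_def_of_ne_zero (mul_ne_zero hx0 hz0), Complex.log_ofReal_mul hx hz0, add_mul,
    Complex.exp_add, Complex.ofReal_log hx.le, ← Complex.cpow_def_of_ne_zero hx0,
    ← Complex.cpow_def_of_ne_zero hz0, Real.sqrt_eq_rpow, Complex.ofReal_cpow hx.le]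
  norm_num

theorem integral_symbolIntegrand (hA : A.IsSymm) (hre : 0 < (quad A w + 1).re) (u : Cn N) :
    ∫ s : ℝ, symbolIntegrand A w u s =
      √(2 * Real.pi) * (1 / (quad A w + 1) ^ (1 / 2 : ℂ)) *
        Complex.exp ((quad A u - (quad A w + 1)⁻¹ * (bilin A w u * bilin A w u)) / 2) := by
  set z := quad A w + 1 with hz
  have hz0 : z ≠ 0 := by rintro h; simp [h] at hre
  have hpi : (Real.pi / -(-(z / 2)) : ℂ) = ((2 * Real.pi : ℝ) : ℂ) / z := by
    push_cast; field_simp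
  have hexp : quad A u / 2 - (Complex.I * bilin A w u) ^ 2 / (4 * (-(z / 2))) =
      (quad A u - z⁻¹ * (bilin A w u * bilin A w u)) / 2 := by
    rw [mul_pow, Complex.I_sq]; field_simp; ring
  rw [← ofReal_div_cpow_half (by positivity) hre, ← hpi, ← hexp,
    ← integral_cexp_quadratic (b := -(z / 2)) (by simpa using hre)]
  refine integral_congr_ae (.of_forall fun s => ?_)
  simp only [symbolIntegrand]
  rw [← Complex.exp_add, quad_add hA, quad_smul, map_smul, LinearMap.smul_apply, smul_eq_mul,
    mul_pow, Complex.I_sq, hz]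
  congr 1
  ring

theorem symbol_closed_form (hA : A.IsSymm) (hre : 0 < (quad A w + 1).re) (u : Cn N) :
    symbol A w u = (1 / √(2 * Real.pi) : ℂ) * (1 / (quad A w + 1) ^ (1 / 2 : ℂ)) *
      Complex.exp ((quad A u - (quad A w + 1)⁻¹ * (bilin A w u * bilin A w u)) / 2) *
        Complex.exp (-(‖u‖ : ℂ) ^ 2 / 2) := by
  have hpi : 0 < 2 * Real.pi := by positivity
  have hs : (√(2 * Real.pi) : ℂ) ≠ 0 := by exact_mod_cast (Real.sqrt_pos.2 hpi).ne'
  have hsq : (2 * Real.pi : ℂ) = (√(2 * Real.pi) : ℂ) * √(2 * Real.pi) := by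
    exact_mod_cast congrArg Complex.ofReal (Real.mul_self_sqrt hpi.le).symm
  rw [symbol, integral_symbolIntegrand hA hre, hsq]
  field_simp

theorem one_div_sqrt_two_pi_mul_ne_zero {z : ℂ} (hz : 0 < z.re) :
    (1 / √(2 * Real.pi) : ℂ) * (1 / z ^ (1 / 2 : ℂ)) ≠ 0 := by
  have hs : (√(2 * Real.pi) : ℂ) ≠ 0 := by
    exact_mod_cast (Real.sqrt_pos.2 (by positivity : (0 : ℝ) < 2 * Real.pi)).ne'
  have hz0 : z ≠ 0 := by rintro rfl; simp at hz
  exact mul_ne_zero (one_div_ne_zero hs)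
    (one_div_ne_zero ((Complex.cpow_ne_zero_iff_of_exponent_ne_zero (by norm_num)).2 hz0))

theorem symbol_zero_ne_zero (hA : A.IsSymm) (hre : 0 < (quad A w + 1).re) : symbol A w 0 ≠ 0 := by
  rw [symbol_closed_form hA hre]
  exact mul_ne_zero (mul_ne_zero (one_div_sqrt_two_pi_mul_ne_zero hre) (Complex.exp_ne_zero _))
    (Complex.exp_ne_zero _)

/-- The quadratic form `Q_{ρ_w(A)}(η) = Q_A(η) - (w A η^T)² / (Q_A(w) + 1)` on `(ℂ w)^⊥` in the
exponent of the symbol. -/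
def reducedForm (A : Matrix (Fin N) (Fin N) ℂ) (w : Cn N) : QuadraticForm ℂ (Horiz w) :=
  (LinearMap.BilinMap.toQuadraticMap (bilin A)).comp (Horiz w).subtype -
    (quad A w + 1)⁻¹ • QuadraticMap.linMulLin ((bilin A w).comp (Horiz w).subtype)
      ((bilin A w).comp (Horiz w).subtype)

theorem reducedForm_apply (η : Horiz w) : reducedForm A w η =
    quad A η - (quad A w + 1)⁻¹ * (bilin A w η * bilin A w η) := rfl

theorem symbol_eq_reducedForm (hA : A.IsSymm) (hre : 0 < (quad A w + 1).re) (η : Horiz w) :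
    symbol A w η = (1 / √(2 * Real.pi) : ℂ) * (1 / (quad A w + 1) ^ (1 / 2 : ℂ)) *
      Complex.exp (reducedForm A w η / 2) * Complex.exp (-(‖η‖ : ℂ) ^ 2 / 2) :=
  symbol_closed_form hA hre η

theorem continuous_reducedForm : Continuous (reducedForm A w) := by
  have hbilin : Continuous (bilin A w) := LinearMap.continuous_of_finiteDimensional _
  change Continuous fun η : Horiz w => reducedForm A w η
  simp only [reducedForm_apply]
  fun_prop

theorem continuous_symbol_horiz (hA : A.IsSymm) (hre : 0 < (quad A w + 1).re) :
    Continuous fun η : Horiz w => symbol A w η := by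
  have := continuous_reducedForm (A := A) (w := w)
  simp only [symbol_eq_reducedForm hA hre]
  fun_prop

theorem inner_horiz_eq_zero (η : Horiz w) : inner ℂ w (η : Cn N) = 0 :=
  Submodule.mem_orthogonal_singleton_iff_inner_right.1 η.2

theorem memLp_two_symbol_horiz (hA : A ∈ disk N) (hw : ‖w‖ = 1) :
    MemLp (fun η : Horiz w => symbol A w η) 2 (lebesgue (Horiz w)) := by
  obtain ⟨r, hr1, hr⟩ := exists_norm_quad_le hA
  obtain ⟨C, -, hC⟩ := exists_norm_symbol_le hw hr1 hr
  have hcont := continuous_symbol_horiz hA.1 (re_quad_add_one_pos hA hw)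
  refine (memLp_two_iff_integrable_sq_norm hcont.aestronglyMeasurable).2 ?_
  refine ((integrable_exp_neg_mul_norm_sq (Horiz w) (b := 2 * ((1 - r) / 40))
    (by linarith)).const_mul (C ^ 2)).mono' (hcont.norm.pow 2).aestronglyMeasurable
      (.of_forall fun η => ?_)
  rw [norm_pow, norm_norm]
  calc ‖symbol A w η‖ ^ 2 ≤ (C * Real.exp (-((1 - r) / 40 * ‖(η : Cn N)‖ ^ 2))) ^ 2 := by
        gcongr; exact hC η (inner_horiz_eq_zero η)
    _ = C ^ 2 * Real.exp (-(2 * ((1 - r) / 40) * ‖η‖ ^ 2)) := by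
        rw [mul_pow, ← Real.exp_nat_mul, Submodule.coe_norm]
        congr 2
        push_cast
        ring

theorem reducedForm_mem_formDisk (hA : A ∈ disk N) (hw : ‖w‖ = 1) :
    reducedForm A w ∈ formDisk (Horiz w) := by
  have hre := re_quad_add_one_pos hA hw
  have hconst := one_div_sqrt_two_pi_mul_ne_zero hre
  have hsymbol := (memLp_two_symbol_horiz hA hw).const_mul
    ((1 / √(2 * Real.pi) : ℂ) * (1 / (quad A w + 1) ^ (1 / 2 : ℂ)))⁻¹
  simpa only [formDisk, Set.mem_ofPred_eq, symbol_eq_reducedForm hA.1 hre,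
    mul_assoc _ (Complex.exp _), inv_mul_cancel_left₀ hconst] using hsymbol

end ClosedForm

section MicroSupport

variable {X : Type*} [TopologicalSpace X] {ρ : ℕ → X → ℝ} {x : X}

theorem notMem_microSupport_of_exp_decay {g : X → ℝ} (hg : Continuous g) {a : ℝ} (ha : 0 < a)
    (h : ∀ k x, |ρ k x| ≤ Real.exp (-(k * a * g x))) (hx : 0 < g x) : x ∉ microSupport ρ := by
  rw [microSupport, Set.mem_ofPred_eq, not_not]
  refine ⟨{y | g x / 2 < g y}, (isOpen_lt continuous_const hg).mem_nhds (half_lt_self hx),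
    fun M => ⟨M.factorial * (a * (g x / 2))⁻¹ ^ M, ?_⟩⟩
  filter_upwards [eventually_ne_atTop 0] with k hk y (hy : g x / 2 < g y)
  have hpos : 0 < k * a * (g x / 2) := by positivity
  have hexp := Real.pow_div_factorial_le_exp _ hpos.le M
  calc |ρ k y| ≤ Real.exp (-(k * a * g y)) := h k y
    _ ≤ Real.exp (-(k * a * (g x / 2))) := by gcongr
    _ ≤ ((k * a * (g x / 2)) ^ M / M.factorial)⁻¹ := by
        rw [Real.exp_neg]; gcongr
    _ = M.factorial * (a * (g x / 2))⁻¹ ^ M * ((k : ℝ) ^ M)⁻¹ := by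
        rw [inv_div, mul_assoc, mul_pow, div_eq_mul_inv, mul_inv, inv_pow]; ring

theorem mem_microSupport_of_tendsto {l : ℝ} (hl : l ≠ 0)
    (h : Tendsto (fun k : ℕ => √(k : ℝ) * ρ k x) atTop (𝓝 l)) : x ∈ microSupport ρ := by
  rintro ⟨U, hU, hM⟩
  obtain ⟨C, hC⟩ := hM 1
  refine hl (tendsto_nhds_unique h ?_)
  have hinv : Tendsto (fun k : ℕ => C * (√(k : ℝ))⁻¹) atTop (𝓝 0) := by
    simpa using (tendsto_inv_atTop_zero.comp
      (Real.tendsto_sqrt_atTop.comp tendsto_natCast_atTop_atTop)).const_mul C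
  refine squeeze_zero_norm' ?_ hinv
  filter_upwards [hC, eventually_ne_atTop 0] with k hk hk0
  have hs : 0 < √(k : ℝ) := by positivity
  have hsq : (k : ℝ) = √(k : ℝ) * √(k : ℝ) := (Real.mul_self_sqrt k.cast_nonneg).symm
  rw [norm_mul, Real.norm_of_nonneg hs.le, Real.norm_eq_abs]
  calc √(k : ℝ) * |ρ k x| ≤ √(k : ℝ) * (C * ((k : ℝ) ^ 1)⁻¹) := by
        gcongr; exact hk x (mem_of_mem_nhds hU)
    _ = C * (√(k : ℝ))⁻¹ := by
        rw [pow_one]; nth_rewrite 2 [hsq]; field_simp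

end MicroSupport

section OrbitGap

variable {N : ℕ} {A : Matrix (Fin N) (Fin N) ℂ} {w z : Cn N}

/-- The squared distance from `z` to the circle orbit of a unit vector `w`. -/
def orbitGap (w z : Cn N) : ℝ := ‖z‖ ^ 2 + 1 - 2 * ‖(inner ℂ w z : ℂ)‖

@[fun_prop]
theorem continuous_orbitGap (w : Cn N) : Continuous (orbitGap w) := by
  unfold orbitGap; fun_prop

theorem norm_rotate_sub_sq (hw : ‖w‖ = 1) (z : Cn N) (t : ℝ) :
    ‖Complex.exp (Complex.I * t) • z - w‖ ^ 2 =
      ‖z‖ ^ 2 + 1 - 2 * (Complex.exp (Complex.I * t) * inner ℂ w z).re := by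
  rw [norm_sub_sq (𝕜 := ℂ), inner_re_symm, inner_smul_right, norm_smul,
    Complex.norm_exp_I_mul_ofReal, hw, RCLike.re_to_complex]
  ring

theorem orbitGap_le_norm_rotate_sub_sq (hw : ‖w‖ = 1) (z : Cn N) (t : ℝ) :
    orbitGap w z ≤ ‖Complex.exp (Complex.I * t) • z - w‖ ^ 2 := by
  have hre := Complex.re_le_norm (Complex.exp (Complex.I * t) * inner ℂ w z)
  rw [norm_mul, Complex.norm_exp_I_mul_ofReal, one_mul] at hre
  rw [norm_rotate_sub_sq hw, orbitGap]
  linarith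

theorem norm_cexp_I_mul_natCast_mul (k : ℕ) (t : ℝ) :
    ‖Complex.exp (Complex.I * k * t)‖ = 1 := by
  have := Complex.norm_exp_I_mul_ofReal (k * t)
  rwa [Complex.ofReal_mul, Complex.ofReal_natCast, ← mul_assoc] at this

theorem norm_reduction_le {k : ℕ} {ψ : Cn N → ℂ} {C : ℝ}
    (h : ∀ t : ℝ, ‖ψ (Complex.exp (Complex.I * t) • z)‖ ≤ C) : ‖reduction k ψ z‖ ≤ C := by
  have hint := intervalIntegral.norm_integral_le_of_norm_le_const (C := C) (a := 0)
    (b := 2 * Real.pi) (f := fun t : ℝ => Complex.exp (-Complex.I * k * t) *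
      ψ (Complex.exp (Complex.I * t) • z)) fun t _ => by
    have hone := norm_cexp_I_mul_natCast_mul k (-t)
    rw [Complex.ofReal_neg, mul_neg, ← neg_mul, ← neg_mul] at hone
    rw [norm_mul, hone, one_mul]
    exact h t
  have hpi : 0 < 2 * Real.pi := by positivity
  rw [sub_zero, abs_of_pos hpi] at hint
  rwa [reduction, norm_mul, norm_div, norm_one, norm_mul, Complex.norm_real, Complex.norm_ofNat,
    Real.norm_of_nonneg Real.pi_pos.le, one_div, inv_mul_le_iff₀ hpi, mul_comm (2 * Real.pi)]

theorem exists_norm_reducedState_le (hA : A ∈ disk N) (hw : ‖w‖ = 1) :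
    ∃ a : ℝ, 0 < a ∧ ∀ (k : ℕ) (z : Cn N),
      ‖reducedState k A w z‖ ≤ Real.exp (-(k * a * orbitGap w z)) := by
  obtain ⟨r, hr1, hr⟩ := exists_norm_quad_le hA
  refine ⟨(1 - r) / 2, by linarith, fun k z => norm_reduction_le fun t => ?_⟩
  refine (norm_coherent_le hr k w _).trans (Real.exp_le_exp.2 ?_)
  have hmul := mul_le_mul_of_nonneg_left (orbitGap_le_norm_rotate_sub_sq hw z t)
    (show 0 ≤ k * ((1 - r) / 2) from mul_nonneg k.cast_nonneg (by linarith))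
  linarith

theorem exists_mem_Icc_cexp_I_mul_eq (t : ℝ) : ∃ s ∈ Set.Icc (0 : ℝ) (2 * Real.pi),
    Complex.exp (Complex.I * s) = Complex.exp (Complex.I * t) := by
  refine ⟨toIcoMod Real.two_pi_pos 0 t, ?_, ?_⟩
  · simpa using Set.Ico_subset_Icc_self (toIcoMod_mem_Ico Real.two_pi_pos 0 t)
  · refine Complex.exp_eq_exp_iff_exists_int.2 ⟨-toIcoDiv Real.two_pi_pos 0 t, ?_⟩
    rw [toIcoMod, zsmul_eq_mul]
    push_cast
    ring

theorem exists_eq_rotate_of_orbitGap_nonpos (hw : ‖w‖ = 1) (hz : orbitGap w z ≤ 0) :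
    ∃ t ∈ Set.Icc (0 : ℝ) (2 * Real.pi), z = Complex.exp (Complex.I * t) • w := by
  set c : ℂ := inner ℂ w z with hc
  have hphase : Complex.exp (Complex.I * ((-c.arg : ℝ) : ℂ)) * c = ‖c‖ := by
    nth_rewrite 2 [← Complex.norm_mul_exp_arg_mul_I c]
    rw [mul_left_comm, ← Complex.exp_add, Complex.ofReal_neg, mul_neg, mul_comm Complex.I,
      neg_add_cancel, Complex.exp_zero, mul_one]
  have hrotate : Complex.exp (Complex.I * ((-c.arg : ℝ) : ℂ)) • z = w := by
    have hdist := norm_rotate_sub_sq hw z (-c.arg)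
    rw [← hc, hphase, Complex.ofReal_re] at hdist
    rw [← sub_eq_zero, ← norm_eq_zero, ← pow_eq_zero_iff two_ne_zero]
    exact le_antisymm (hdist.trans_le hz) (sq_nonneg _)
  obtain ⟨t, ht, heq⟩ := exists_mem_Icc_cexp_I_mul_eq c.arg
  refine ⟨t, ht, ?_⟩
  rw [heq, ← hrotate, smul_smul, ← Complex.exp_add, ← mul_add, ← Complex.ofReal_add,
    add_neg_cancel, Complex.ofReal_zero, mul_zero, Complex.exp_zero, one_smul]

theorem tendsto_sqrt_mul_norm_reducedState_rotate (hA : A ∈ disk N) (hw : ‖w‖ = 1) (t : ℝ) :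
    Tendsto (fun k : ℕ => √(k : ℝ) * ‖reducedState k A w (Complex.exp (Complex.I * t) • w)‖) atTop
      (𝓝 ‖symbol A w 0‖) := by
  refine (tendsto_sqrt_mul_reducedState hA hw (inner_zero_right w)).norm.congr fun k => ?_
  rw [smul_zero, add_zero, norm_mul, Complex.norm_real, Real.norm_of_nonneg (Real.sqrt_nonneg _),
    reducedState, reduction_rotate, norm_mul, norm_cexp_I_mul_natCast_mul, one_mul]

theorem norm_symbol_zero_ne_zero (hA : A ∈ disk N) (hw : ‖w‖ = 1) : ‖symbol A w 0‖ ≠ 0 :=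
  norm_ne_zero_iff.2 (symbol_zero_ne_zero hA.1 (re_quad_add_one_pos hA hw))

theorem microSupport_reducedState (hA : A ∈ disk N) (hw : ‖w‖ = 1) :
    microSupport (fun k (z : Cn N) => ‖reducedState k A w z‖) =
      {z | ∃ t ∈ Set.Icc (0 : ℝ) (2 * Real.pi), z = Complex.exp (Complex.I * t) • w} := by
  obtain ⟨a, ha, hdecay⟩ := exists_norm_reducedState_le hA hw
  ext z
  refine ⟨fun hz => exists_eq_rotate_of_orbitGap_nonpos hw (not_lt.1 fun hpos => ?_), ?_⟩
  · refine notMem_microSupport_of_exp_decay (continuous_orbitGap w) ha (fun k x => ?_) hpos hz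
    rw [abs_norm]
    exact hdecay k x
  · rintro ⟨t, -, rfl⟩
    exact mem_microSupport_of_tendsto (norm_symbol_zero_ne_zero hA hw)
      (tendsto_sqrt_mul_norm_reducedState_rotate hA hw t)

theorem microSupport_reducedState_sphere (hA : A ∈ disk N) (w : Sph N) :
    microSupport (fun k (z : Sph N) => ‖reducedState k A w z‖) =
      {z | ∃ t ∈ Set.Icc (0 : ℝ) (2 * Real.pi), z = rotate t w} := by
  have hw : ‖(w : Cn N)‖ = 1 := norm_eq_of_mem_sphere w
  obtain ⟨a, ha, hdecay⟩ := exists_norm_reducedState_le hA hw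
  ext z
  refine ⟨fun hz => ?_, ?_⟩
  · have hgap : orbitGap (w : Cn N) z ≤ 0 := not_lt.1 fun hpos =>
      notMem_microSupport_of_exp_decay (g := fun z : Sph N => orbitGap (w : Cn N) z)
        (by fun_prop) ha (fun k x => by rw [abs_norm]; exact hdecay k x) hpos hz
    obtain ⟨t, ht, hzt⟩ := exists_eq_rotate_of_orbitGap_nonpos hw hgap
    exact ⟨t, ht, Subtype.ext hzt⟩
  · rintro ⟨t, -, rfl⟩
    exact mem_microSupport_of_tendsto (norm_symbol_zero_ne_zero hA hw)
      (tendsto_sqrt_mul_norm_reducedState_rotate hA hw t)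

end OrbitGap

section Projective

variable {N : ℕ} {A : Matrix (Fin N) (Fin N) ℂ}

theorem hopf_surjective : Function.Surjective (hopf (N := N)) := by
  intro p
  induction p using Projectivization.ind with
  | h v hv => exact ⟨toSph ⟨v, hv⟩, (Projectivization.mk_eq_mk_iff' ℂ _ _ _ _).2 ⟨(‖v‖ : ℂ)⁻¹, rfl⟩⟩

/-- The function on `ℂP^{N-1}` induced by `orbitGap`. -/
def orbitGapCP (w : Cn N) : CP N → ℝ :=
  Projectivization.lift (fun v => 2 - 2 * (‖(inner ℂ w (v : Cn N) : ℂ)‖ / ‖(v : Cn N)‖)) (by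
    rintro ⟨a, ha⟩ ⟨b, hb⟩ t (h : a = t • b)
    subst h
    have ht : ‖t‖ ≠ 0 := fun h0 => ha (by rw [norm_eq_zero.1 h0, zero_smul])
    simp only [inner_smul_right, norm_smul, norm_mul]
    rw [mul_div_mul_left _ _ ht])

theorem orbitGapCP_hopf (w : Cn N) (z : Sph N) : orbitGapCP w (hopf z) = orbitGap w z := by
  simp only [orbitGapCP, hopf, Projectivization.lift_mk, norm_eq_of_mem_sphere, orbitGap]
  ring

theorem continuous_orbitGapCP (w : Cn N) : Continuous (orbitGapCP w) := by
  refine continuous_coinduced_dom.2 ?_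
  simp only [Function.comp_def, orbitGapCP_hopf]
  fun_prop

theorem size_reducedSection_hopf (k : ℕ) (w : Cn N) (z : Sph N) :
    (reducedSection k A w (hopf z)).size = ‖reducedState k A w z‖ :=
  congrArg Bundle.size (sectionOf_hopf k (fun z : Sph N => reducedState k A w z)
    (fun θ z => reduction_rotate k (coherent k A w) θ z) z)

theorem microSupport_reducedSection (hA : A ∈ disk N) (w : Sph N) :
    microSupport (fun k (p : CP N) => (reducedSection k A w p).size) = {hopf w} := by
  have hw : ‖(w : Cn N)‖ = 1 := norm_eq_of_mem_sphere w
  obtain ⟨a, ha, hdecay⟩ := exists_norm_reducedState_le hA hw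
  ext p
  obtain ⟨z, rfl⟩ := hopf_surjective p
  refine ⟨fun hz => ?_, ?_⟩
  · have hgap : orbitGap (w : Cn N) z ≤ 0 := not_lt.1 fun hpos => by
      rw [← orbitGapCP_hopf] at hpos
      refine notMem_microSupport_of_exp_decay (continuous_orbitGapCP (w : Cn N)) ha
        (fun k x => ?_) hpos hz
      obtain ⟨y, rfl⟩ := hopf_surjective x
      rw [size_reducedSection_hopf, abs_norm, orbitGapCP_hopf]
      exact hdecay k y
    obtain ⟨t, -, hzt⟩ := exists_eq_rotate_of_orbitGap_nonpos hw hgap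
    rw [show z = rotate t w from Subtype.ext hzt, hopf_rotate]
    rfl
  · intro h
    rw [Set.mem_singleton_iff.1 h]
    refine mem_microSupport_of_tendsto (norm_symbol_zero_ne_zero hA hw) ?_
    simp_rw [size_reducedSection_hopf]
    simpa using tendsto_sqrt_mul_norm_reducedState_rotate hA hw 0

end Projective

section PolarCoordinates

theorem lintegral_Ioi_mul_comp_sqrt {a : ℝ} (ha : 0 ≤ a) (g : ℝ → ℝ≥0∞) :
    ∫⁻ ρ in Set.Ioi (0 : ℝ), ENNReal.ofReal ρ * g ρ =
      ∫⁻ r in Set.Ioi a, ENNReal.ofReal r * g √(r ^ 2 - a ^ 2) := by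
  have hpos {r : ℝ} (hr : r ∈ Set.Ioi a) : 0 < r ^ 2 - a ^ 2 :=
    sub_pos.2 (pow_lt_pow_left₀ hr ha two_ne_zero)
  have himage : (fun r : ℝ => √(r ^ 2 - a ^ 2)) '' Set.Ioi a = Set.Ioi 0 := by
    refine Set.Subset.antisymm (Set.image_subset_iff.2 fun r hr => Real.sqrt_pos.2 (hpos hr))
      fun ρ (hρ : 0 < ρ) => ⟨√(ρ ^ 2 + a ^ 2), Real.lt_sqrt_of_sq_lt (by nlinarith), ?_⟩
    simp only [Real.sq_sqrt (add_nonneg (sq_nonneg ρ) (sq_nonneg a)), add_sub_cancel_right,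
      Real.sqrt_sq hρ.le]
  have hinj : Set.InjOn (fun r : ℝ => √(r ^ 2 - a ^ 2)) (Set.Ioi a) := fun r hr s hs h =>
    (sq_eq_sq₀ (ha.trans (le_of_lt hr)) (ha.trans (le_of_lt hs))).1
      (sub_left_inj.1 ((Real.sqrt_inj (hpos hr).le (hpos hs).le).1 h))
  have hderiv : ∀ r ∈ Set.Ioi a, HasDerivWithinAt (fun r : ℝ => √(r ^ 2 - a ^ 2))
      (r / √(r ^ 2 - a ^ 2)) (Set.Ioi a) r := fun r hr => by
    refine ((((hasDerivAt_pow 2 r).sub_const (a ^ 2)).sqrt (hpos hr).ne').congr_deriv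
      ?_).hasDerivWithinAt
    simp only [Nat.cast_ofNat, Nat.add_one_sub_one, pow_one]
    rw [mul_div_mul_left _ _ two_ne_zero]
  rw [← himage, lintegral_image_eq_lintegral_abs_deriv_mul measurableSet_Ioi hderiv hinj]
  refine setLIntegral_congr_fun measurableSet_Ioi fun r hr => ?_
  have hr0 : 0 ≤ r := ha.trans (le_of_lt hr)
  have hsqrt : 0 < √(r ^ 2 - a ^ 2) := Real.sqrt_pos.2 (hpos hr)
  rw [← mul_assoc, ← ENNReal.ofReal_mul (abs_nonneg _), abs_of_nonneg (by positivity),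
    div_mul_cancel₀ _ hsqrt.ne']

variable {E : Type*} [NormedAddCommGroup E] [NormedSpace ℝ E] [FiniteDimensional ℝ E]
  [MeasurableSpace E] [BorelSpace E] (μ : Measure E)

theorem setLIntegral_ball_comp_smul [μ.IsAddHaarMeasure] {g : E → ℝ≥0∞} (hg : Measurable g)
    {r : ℝ} (hr : 0 < r) :
    ∫⁻ ζ in Metric.ball 0 r, g ζ ∂μ =
      ENNReal.ofReal (r ^ Module.finrank ℝ E) * ∫⁻ η in Metric.ball 0 1, g (r • η) ∂μ := by
  have hball : (fun η : E => r • η) ⁻¹' Metric.ball 0 r = Metric.ball 0 1 := by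
    ext η
    simp [norm_smul, abs_of_pos hr, mul_lt_iff_lt_one_right hr]
  have hr' : 0 < r ^ Module.finrank ℝ E := pow_pos hr _
  rw [← hball, ← setLIntegral_map Metric.isOpen_ball.measurableSet hg
    (measurable_const_smul r), Measure.map_addHaar_smul μ hr.ne', Measure.restrict_smul,
    lintegral_smul_measure, smul_eq_mul, ← mul_assoc, ← ENNReal.ofReal_mul hr'.le,
    abs_of_pos (inv_pos.2 hr'), mul_inv_cancel₀ hr'.ne', ENNReal.ofReal_one, one_mul]

theorem setLIntegral_ball_mul_comp_sqrt [μ.IsAddHaarMeasure] {g : ℝ → E → ℝ≥0∞}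
    (hg : Measurable (Function.uncurry g)) {r : ℝ} (hr : 0 < r) :
    ∫⁻ ζ in Metric.ball 0 r, ENNReal.ofReal r * g √(r ^ 2 - ‖ζ‖ ^ 2) ζ ∂μ =
      ENNReal.ofReal (r ^ (Module.finrank ℝ E + 1)) *
        ∫⁻ η in Metric.ball 0 1, g (r * √(1 - ‖η‖ ^ 2)) (r • η) ∂μ := by
  have hscale (η : E) : √(r ^ 2 - ‖r • η‖ ^ 2) = r * √(1 - ‖η‖ ^ 2) := by
    rw [norm_smul, Real.norm_of_nonneg hr.le, mul_pow, ← mul_one_sub,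
      Real.sqrt_mul (sq_nonneg r), Real.sqrt_sq hr.le]
  have hgr : Measurable fun ζ => g √(r ^ 2 - ‖ζ‖ ^ 2) ζ :=
    hg.comp (f := fun ζ : E => (√(r ^ 2 - ‖ζ‖ ^ 2), ζ)) (by fun_prop)
  rw [lintegral_const_mul _ hgr, setLIntegral_ball_comp_smul μ hgr hr, ← mul_assoc,
    ← ENNReal.ofReal_mul hr.le, ← pow_succ']
  simp_rw [hscale]

/-- The substitution `(ρ, ζ) = (r √(1 - ‖η‖²), r η)` on a half-space. -/
theorem lintegral_Ioi_mul_lintegral [μ.IsAddHaarMeasure] {g : ℝ → E → ℝ≥0∞}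
    (hg : Measurable (Function.uncurry g)) :
    ∫⁻ ρ in Set.Ioi (0 : ℝ), ENNReal.ofReal ρ * ∫⁻ ζ, g ρ ζ ∂μ =
      ∫⁻ r in Set.Ioi (0 : ℝ), ENNReal.ofReal (r ^ (Module.finrank ℝ E + 1)) *
        ∫⁻ η in Metric.ball 0 1, g (r * √(1 - ‖η‖ ^ 2)) (r • η) ∂μ := by
  set G : ℝ → E → ℝ≥0∞ := fun r => (Metric.ball 0 r).indicator
    fun ζ => ENNReal.ofReal r * g √(r ^ 2 - ‖ζ‖ ^ 2) ζ with hG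
  have hGm : Measurable (Function.uncurry G) := by
    have hball : Function.uncurry G = {p : ℝ × E | ‖p.2‖ < p.1}.indicator
        fun p => ENNReal.ofReal p.1 * g √(p.1 ^ 2 - ‖p.2‖ ^ 2) p.2 := by
      classical
      ext p
      simp [hG, Function.uncurry, Set.indicator_apply]
    rw [hball]
    exact ((measurable_fst.ennreal_ofReal).mul
      (hg.comp (f := fun p : ℝ × E => (√(p.1 ^ 2 - ‖p.2‖ ^ 2), p.2)) (by fun_prop))).indicator
        (measurableSet_lt measurable_snd.norm measurable_fst)
  calc _ = ∫⁻ ρ in Set.Ioi (0 : ℝ), (∫⁻ ζ, ENNReal.ofReal ρ * g ρ ζ ∂μ) :=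
        lintegral_congr fun ρ => (lintegral_const_mul _ hg.of_uncurry_left).symm
    _ = ∫⁻ ζ, (∫⁻ ρ in Set.Ioi (0 : ℝ), ENNReal.ofReal ρ * g ρ ζ) ∂μ :=
        lintegral_lintegral_swap (measurable_fst.ennreal_ofReal.mul hg).aemeasurable
    _ = ∫⁻ ζ, (∫⁻ r in Set.Ioi (0 : ℝ), G r ζ) ∂μ := lintegral_congr fun ζ => by
        have hind : (G · ζ) = (Set.Ioi ‖ζ‖).indicator
            fun r => ENNReal.ofReal r * g √(r ^ 2 - ‖ζ‖ ^ 2) ζ := by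
          classical
          ext r
          simp [hG, Set.indicator_apply]
        rw [lintegral_Ioi_mul_comp_sqrt (norm_nonneg ζ) (g · ζ), hind,
          setLIntegral_indicator measurableSet_Ioi, Set.Ioi_inter_Ioi,
          sup_of_le_left (norm_nonneg ζ)]
    _ = ∫⁻ r in Set.Ioi (0 : ℝ), (∫⁻ ζ, G r ζ ∂μ) :=
        (lintegral_lintegral_swap hGm.aemeasurable).symm
    _ = _ := setLIntegral_congr_fun measurableSet_Ioi fun r (hr : 0 < r) => by
        simp only [hG]
        rw [lintegral_indicator Metric.isOpen_ball.measurableSet,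
          setLIntegral_ball_mul_comp_sqrt μ hg hr]

theorem natCast_mul_lintegral_Ioo_pow {d : ℕ} (hd : d ≠ 0) :
    (d : ℝ≥0∞) * ∫⁻ r in Set.Ioo (0 : ℝ) 1, ENNReal.ofReal (r ^ (d - 1)) = 1 := by
  obtain ⟨n, rfl⟩ := Nat.exists_eq_succ_of_ne_zero hd
  have hint : IntegrableOn (fun r : ℝ => r ^ n) (Set.Ioc 0 1) :=
    (intervalIntegrable_iff_integrableOn_Ioc_of_le zero_le_one).1
      (intervalIntegral.intervalIntegrable_pow n)
  rw [restrict_Ioo_eq_restrict_Ioc, Nat.succ_sub_one, ← ofReal_integral_eq_lintegral_ofReal hint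
    ((ae_restrict_iff' measurableSet_Ioc).2 (.of_forall fun r hr => pow_nonneg hr.1.le n)),
    ← intervalIntegral.integral_of_le zero_le_one, integral_pow, ← ENNReal.ofReal_natCast,
    ← ENNReal.ofReal_mul (Nat.cast_nonneg _)]
  simp [Nat.cast_add_one_ne_zero n]

theorem Ioo_smul_image_sphere {E : Type*} [NormedAddCommGroup E] [NormedSpace ℝ E] (s : Set E) :
    Set.Ioo (0 : ℝ) 1 • (((↑) : Metric.sphere (0 : E) 1 → E) '' ((↑) ⁻¹' s)) =
      {z | ‖z‖ ∈ Set.Ioo (0 : ℝ) 1 ∧ ‖z‖⁻¹ • z ∈ s} := by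
  ext z
  rw [Set.mem_smul]
  constructor
  · rintro ⟨r, hr, _, ⟨x, hx, rfl⟩, rfl⟩
    have hnorm : ‖r • (x : E)‖ = r := by
      rw [norm_smul, Real.norm_of_nonneg hr.1.le, norm_eq_of_mem_sphere x, mul_one]
    refine ⟨by rwa [hnorm], ?_⟩
    rwa [hnorm, inv_smul_smul₀ hr.1.ne']
  · rintro ⟨hz, hs⟩
    refine ⟨‖z‖, hz, ‖z‖⁻¹ • z, ⟨⟨‖z‖⁻¹ • z, ?_⟩, hs, rfl⟩, smul_inv_smul₀ hz.1.ne' z⟩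
    rw [mem_sphere_zero_iff_norm, norm_smul, norm_inv, norm_norm, inv_mul_cancel₀ hz.1.ne']

theorem map_toSphere_eq_of_lintegral_eq [Nontrivial E] {ν : Measure E}
    (hnorm : ∀ᵐ x ∂ν, ‖x‖ = 1)
    (hpolar : ∀ f : E → ℝ≥0∞, Measurable f → ∫⁻ z, f z ∂μ =
      ∫⁻ r in Set.Ioi (0 : ℝ), ENNReal.ofReal (r ^ (Module.finrank ℝ E - 1)) *
        ∫⁻ x, f (r • x) ∂ν) :
    μ.toSphere.map ((↑) : Metric.sphere (0 : E) 1 → E) = ν := by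
  ext s hs
  set cone : Set E := {z | ‖z‖ ∈ Set.Ioo (0 : ℝ) 1 ∧ ‖z‖⁻¹ • z ∈ s} with hcone
  have hcone_meas : MeasurableSet cone :=
    (measurable_norm measurableSet_Ioo).inter ((measurable_norm.inv.smul measurable_id) hs)
  have hsection (r : ℝ) (hr : 0 < r) : ∫⁻ x, cone.indicator 1 (r • x) ∂ν =
      (Set.Iio (1 : ℝ)).indicator (fun _ => ν s) r := by
    have hmem : ∀ᵐ x ∂ν, r • x ∈ cone ↔ r < 1 ∧ x ∈ s := hnorm.mono fun x hx => by
      have hrx : ‖r • x‖ = r := by rw [norm_smul, Real.norm_of_nonneg hr.le, hx, mul_one]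
      rw [hcone, Set.mem_ofPred_eq, hrx, inv_smul_smul₀ hr.ne', Set.mem_Ioo, and_iff_right hr]
    by_cases h1 : r < 1
    · rw [Set.indicator_of_mem (Set.mem_Iio.2 h1), ← lintegral_indicator_one hs]
      refine lintegral_congr_ae (hmem.mono fun x hx => ?_)
      classical
      simp [Set.indicator_apply, hx, h1]
    · rw [Set.indicator_of_notMem (by simpa using h1)]
      refine lintegral_eq_zero_of_ae_eq_zero (hmem.mono fun x hx => ?_)
      exact Set.indicator_of_notMem (fun h => h1 (hx.1 h).1) _
  calc μ.toSphere.map (↑) s = Module.finrank ℝ E * μ cone := by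
        rw [Measure.map_apply measurable_subtype_coe hs,
          Measure.toSphere_apply' _ (measurable_subtype_coe hs), Ioo_smul_image_sphere]
    _ = Module.finrank ℝ E * ∫⁻ r in Set.Ioi (0 : ℝ), (Set.Iio (1 : ℝ)).indicator
          (fun r => ENNReal.ofReal (r ^ (Module.finrank ℝ E - 1)) * ν s) r := by
        rw [← lintegral_indicator_one hcone_meas, hpolar _ (measurable_one.indicator hcone_meas)]
        congr 1
        refine setLIntegral_congr_fun measurableSet_Ioi fun r hr => ?_
        simp only [hsection r hr, Set.indicator_apply, mul_ite, mul_zero]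
    _ = ν s := by
        rw [setLIntegral_indicator measurableSet_Iio, Set.inter_comm, Set.Ioi_inter_Iio,
          lintegral_mul_const _ (by fun_prop), ← mul_assoc,
          natCast_mul_lintegral_Ioo_pow Module.finrank_pos.ne', one_mul]

end PolarCoordinates

section HopfChart

variable {N : ℕ} {w : Cn N}

theorem ne_zero_of_norm_eq_one (hw : ‖w‖ = 1) : N ≠ 0 := by
  rintro rfl
  rw [Subsingleton.elim w 0, norm_zero] at hw
  exact zero_ne_one hw

theorem finrank_real_Cn (N : ℕ) : Module.finrank ℝ (Cn N) = 2 * N := by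
  rw [← Module.finrank_mul_finrank ℝ ℂ (Cn N), Complex.finrank_real_complex,
    finrank_euclideanSpace_fin]

theorem finrank_real_horiz (hw : ‖w‖ = 1) : Module.finrank ℝ (Horiz w) = 2 * (N - 1) := by
  have hw0 : w ≠ 0 := norm_ne_zero_iff.1 (hw.trans_ne one_ne_zero)
  have h := Submodule.finrank_add_finrank_orthogonal (Submodule.span ℂ {w})
  rw [finrank_span_singleton hw0, finrank_euclideanSpace_fin] at h
  rw [← Module.finrank_mul_finrank ℝ ℂ (Horiz w), Complex.finrank_real_complex,
    ← Nat.eq_sub_of_add_eq' h]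

theorem finrank_real_horiz_add_one (hw : ‖w‖ = 1) :
    Module.finrank ℝ (Horiz w) + 1 = Module.finrank ℝ (Cn N) - 1 := by
  have := ne_zero_of_norm_eq_one hw
  rw [finrank_real_horiz hw, finrank_real_Cn]
  omega

/-- The isometry `ℂ ⊕ (ℂ w)^⊥ → ℂ^N`, `(a, ζ) ↦ a w + ζ`. -/
def splitIsometry (hw : ‖w‖ = 1) : WithLp 2 (ℂ × Horiz w) ≃ₗᵢ[ℝ] Cn N :=
  LinearIsometryEquiv.ofSurjective
    { toFun := fun p => p.fst • w + (p.snd : Cn N)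
      map_add' := fun p q => by
        simp only [WithLp.add_fst, WithLp.add_snd, Submodule.coe_add]
        module
      map_smul' := fun a p => by simp [mul_smul]
      norm_map' := fun p => by
        refine (sq_eq_sq₀ (norm_nonneg _) (norm_nonneg _)).1 ?_
        exact (norm_smul_add_sq hw (inner_horiz_eq_zero p.snd) p.fst).trans
          (WithLp.prod_norm_sq_eq_of_L2 p).symm }
    (fun z => by
      have h : z - (inner ℂ w z : ℂ) • w ∈ Horiz w := by
        rw [Submodule.mem_orthogonal_singleton_iff_inner_right, inner_sub_right, inner_smul_right,
          inner_self_eq_norm_sq_to_K, hw]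
        simp
      exact ⟨WithLp.toLp 2 ((inner ℂ w z : ℂ), ⟨_, h⟩), add_sub_cancel _ _⟩)

theorem measurePreserving_split (hw : ‖w‖ = 1) :
    MeasurePreserving (fun p : ℂ × Horiz w => p.1 • w + (p.2 : Cn N))
      ((volume : Measure ℂ).prod (lebesgue (Horiz w))) (lebesgue (Cn N)) := by
  let _ : InnerProductSpace ℝ (Horiz w) := InnerProductSpace.rclikeToReal ℂ (Horiz w)
  let _ : InnerProductSpace ℝ (Cn N) := InnerProductSpace.rclikeToReal ℂ (Cn N)
  exact (splitIsometry hw).measurePreserving.comp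
    (WithLp.volume_preserving_symm_measurableEquiv_toLp_prod ℂ (Horiz w)).symm

/-- The parametrization of the unit sphere by the angle and the horizontal coordinate. -/
def hopfChart (w : Cn N) (θ : ℝ) (η : Horiz w) : Cn N :=
  ((√(1 - ‖η‖ ^ 2) : ℂ) * Complex.exp (Complex.I * θ)) • w + (η : Cn N)

theorem continuous_hopfChart (w : Cn N) :
    Continuous fun p : ℝ × Horiz w => hopfChart w p.1 p.2 := by
  unfold hopfChart; fun_prop

theorem norm_hopfChart (hw : ‖w‖ = 1) (θ : ℝ) {η : Horiz w} (hη : ‖η‖ ≤ 1) :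
    ‖hopfChart w θ η‖ = 1 := by
  have h := norm_smul_add_sq hw (inner_horiz_eq_zero η)
    ((√(1 - ‖η‖ ^ 2) : ℂ) * Complex.exp (Complex.I * θ))
  rw [norm_mul, Complex.norm_exp_I_mul_ofReal, Complex.norm_real,
    Real.norm_of_nonneg (Real.sqrt_nonneg _), mul_one,
    Real.sq_sqrt (sub_nonneg.2 (pow_le_one₀ (norm_nonneg _) hη)), Submodule.norm_coe,
    sub_add_cancel] at h
  exact (pow_eq_one_iff_of_nonneg (norm_nonneg _) two_ne_zero).1 h

/-- The surface measure of the unit sphere in the coordinates of `hopfChart`, where it is the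
product of the Lebesgue measures of an interval and of the unit ball of `(ℂ w)^⊥`. -/
def hopfMeasure (w : Cn N) : Measure (Cn N) :=
  ((volume.restrict (Set.Ioo (-Real.pi) Real.pi)).prod
    ((lebesgue (Horiz w)).restrict (Metric.ball 0 1))).map fun p => hopfChart w p.1 p.2

theorem lintegral_hopfMeasure {f : Cn N → ℝ≥0∞} (hf : Measurable f) :
    ∫⁻ x, f x ∂hopfMeasure w = ∫⁻ θ in Set.Ioo (-Real.pi) Real.pi,
      (∫⁻ η in Metric.ball (0 : Horiz w) 1, f (hopfChart w θ η) ∂lebesgue (Horiz w)) := by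
  have hΦ := (continuous_hopfChart w).measurable
  rw [hopfMeasure, lintegral_map hf hΦ]
  exact lintegral_prod _ (hf.comp hΦ).aemeasurable

theorem ae_norm_eq_one_hopfMeasure (hw : ‖w‖ = 1) : ∀ᵐ x ∂hopfMeasure w, ‖x‖ = 1 := by
  have hmeas : MeasurableSet {x : Cn N | ‖x‖ = 1} := measurable_norm (measurableSet_singleton 1)
  rw [hopfMeasure, ae_map_iff (continuous_hopfChart w).measurable.aemeasurable hmeas,
    Measure.prod_restrict]
  refine ae_restrict_of_forall_mem (measurableSet_Ioo.prod Metric.isOpen_ball.measurableSet) ?_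
  exact fun p hp => norm_hopfChart hw p.1 (mem_ball_zero_iff.1 hp.2).le

theorem lintegral_eq_lintegral_polar_horiz (hw : ‖w‖ = 1) {f : Cn N → ℝ≥0∞}
    (hf : Measurable f) :
    ∫⁻ z, f z ∂lebesgue (Cn N) = ∫⁻ θ in Set.Ioo (-Real.pi) Real.pi,
      (∫⁻ ρ in Set.Ioi (0 : ℝ), ENNReal.ofReal ρ *
        ∫⁻ ζ : Horiz w, f (((ρ : ℂ) * Complex.exp (Complex.I * θ)) • w + (ζ : Cn N))
          ∂lebesgue (Horiz w)) := by
  have hsplit := measurePreserving_split hw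
  have hm : Measurable fun p : ℂ × Horiz w => f (p.1 • w + (p.2 : Cn N)) :=
    hf.comp hsplit.measurable
  have htarget : polarCoord.target = Set.Ioi (0 : ℝ) ×ˢ Set.Ioo (-Real.pi) Real.pi := rfl
  have hpolar (p : ℝ × ℝ) :
      Complex.polarCoord.symm p = (p.1 : ℂ) * Complex.exp (Complex.I * p.2) := by
    rw [Complex.polarCoord_symm_apply, mul_comm Complex.I, Complex.exp_mul_I, Complex.ofReal_cos,
      Complex.ofReal_sin]
  rw [← hsplit.lintegral_comp hf, lintegral_prod _ hm.aemeasurable,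
    ← Complex.lintegral_comp_polarCoord_symm, htarget, Measure.volume_eq_prod,
    ← Measure.prod_restrict, lintegral_prod_symm]
  · simp only [hpolar, smul_eq_mul]
  · simp only [hpolar, smul_eq_mul]
    refine (measurable_fst.ennreal_ofReal.mul (hm.lintegral_prod_right'.comp
      (Continuous.measurable ?_))).aemeasurable
    fun_prop

theorem lintegral_eq_lintegral_hopfMeasure (hw : ‖w‖ = 1) {f : Cn N → ℝ≥0∞}
    (hf : Measurable f) :
    ∫⁻ z, f z ∂lebesgue (Cn N) = ∫⁻ r in Set.Ioi (0 : ℝ),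
      ENNReal.ofReal (r ^ (Module.finrank ℝ (Cn N) - 1)) * ∫⁻ x, f (r • x) ∂hopfMeasure w := by
  have hchart (r θ : ℝ) (η : Horiz w) :
      (((r * √(1 - ‖η‖ ^ 2) : ℝ) : ℂ) * Complex.exp (Complex.I * θ)) • w +
        ((r • η : Horiz w) : Cn N) = r • hopfChart w θ η := by
    rw [hopfChart, smul_add, Complex.ofReal_mul, mul_assoc, mul_smul, Complex.coe_smul]
    rfl
  have hmeas : Measurable fun p : (ℝ × ℝ) × Horiz w => f (p.1.2 • hopfChart w p.1.1 p.2) :=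
    hf.comp (Continuous.measurable (by unfold hopfChart; fun_prop))
  have hball : Measurable fun p : ℝ × ℝ => ENNReal.ofReal (p.2 ^ (Module.finrank ℝ (Horiz w) + 1)) *
      ∫⁻ η in Metric.ball (0 : Horiz w) 1, f (p.2 • hopfChart w p.1 η) ∂lebesgue (Horiz w) :=
    (measurable_snd.pow_const _).ennreal_ofReal.mul hmeas.lintegral_prod_right'
  rw [lintegral_eq_lintegral_polar_horiz hw hf]
  calc _ = ∫⁻ θ in Set.Ioo (-Real.pi) Real.pi, (∫⁻ r in Set.Ioi (0 : ℝ),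
          ENNReal.ofReal (r ^ (Module.finrank ℝ (Horiz w) + 1)) *
            ∫⁻ η in Metric.ball (0 : Horiz w) 1, f (r • hopfChart w θ η)
              ∂lebesgue (Horiz w)) := lintegral_congr fun θ => by
        have hg : Measurable (Function.uncurry fun (ρ : ℝ) (ζ : Horiz w) =>
            f (((ρ : ℂ) * Complex.exp (Complex.I * θ)) • w + (ζ : Cn N))) :=
          hf.comp (Continuous.measurable (by fun_prop))
        rw [lintegral_Ioi_mul_lintegral _ hg]
        simp only [hchart]
    _ = _ := by
        rw [lintegral_lintegral_swap hball.aemeasurable]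
        refine lintegral_congr fun r => ?_
        rw [← finrank_real_horiz_add_one hw,
          lintegral_hopfMeasure (f := (f <| r • ·)) (hf.comp (measurable_const_smul r))]
        exact lintegral_const_mul _
          (hmeas.lintegral_prod_right'.comp (measurable_id.prodMk measurable_const))

theorem map_toSphere_eq_hopfMeasure (hw : ‖w‖ = 1) :
    (lebesgue (Cn N)).toSphere.map ((↑) : Sph N → Cn N) = hopfMeasure w :=
  have : Nontrivial (Cn N) := ⟨w, 0, norm_ne_zero_iff.1 (hw.trans_ne one_ne_zero)⟩
  map_toSphere_eq_of_lintegral_eq _ (ae_norm_eq_one_hopfMeasure hw)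
    fun _ hf => lintegral_eq_lintegral_hopfMeasure hw hf

end HopfChart

section SphereIntegral

theorem measurePreserving_exp_smul (H : Type*) [NormedAddCommGroup H] [InnerProductSpace ℂ H]
    [FiniteDimensional ℂ H] [MeasurableSpace H] [BorelSpace H] (t : ℝ) :
    MeasurePreserving (fun v : H => Complex.exp (Complex.I * t) • v) (lebesgue H) (lebesgue H) := by
  let _ : InnerProductSpace ℝ H := InnerProductSpace.rclikeToReal ℂ H
  let e : H ≃ₗᵢ[ℝ] H :=
    { (LinearEquiv.smulOfNeZero ℂ H _ (Complex.exp_ne_zero (Complex.I * t))).restrictScalars ℝ with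
      norm_map' := fun v => by
        change ‖Complex.exp (Complex.I * t) • v‖ = ‖v‖
        rw [norm_smul, Complex.norm_exp_I_mul_ofReal, one_mul] }
  exact e.measurePreserving

theorem setIntegral_ball_exp_smul {H : Type*} [NormedAddCommGroup H] [InnerProductSpace ℂ H]
    [FiniteDimensional ℂ H] [MeasurableSpace H] [BorelSpace H] {E : Type*} [NormedAddCommGroup E]
    [NormedSpace ℝ E] (g : H → E) (t r : ℝ) :
    ∫ v in Metric.ball 0 r, g (Complex.exp (Complex.I * t) • v) ∂lebesgue H =
      ∫ v in Metric.ball 0 r, g v ∂lebesgue H := by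
  have hemb : MeasurableEmbedding fun v : H => Complex.exp (Complex.I * t) • v :=
    (Homeomorph.smulOfNeZero _ (Complex.exp_ne_zero (Complex.I * t))).measurableEmbedding
  rw [← (measurePreserving_exp_smul H t).setIntegral_preimage_emb hemb g]
  congr 2
  ext v
  simp [norm_smul]

variable {N : ℕ} {w : Cn N}

theorem hopfChart_exp_smul (w : Cn N) (θ : ℝ) (η : Horiz w) :
    hopfChart w θ (Complex.exp (Complex.I * θ) • η) =
      Complex.exp (Complex.I * θ) • ((√(1 - ‖η‖ ^ 2) : ℂ) • w + (η : Cn N)) := by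
  rw [hopfChart, norm_smul, Complex.norm_exp_I_mul_ofReal, one_mul, smul_add, smul_smul,
    mul_comm (Complex.exp _), Submodule.coe_smul]

theorem integral_toSphere_eq (hw : ‖w‖ = 1) {F : Cn N → ℂ} (hF : Continuous F)
    (hinv : ∀ (t : ℝ) (z : Cn N), F (Complex.exp (Complex.I * t) • z) = F z) :
    ∫ z : Sph N, F z ∂(lebesgue (Cn N)).toSphere =
      2 * Real.pi * ∫ η in Metric.ball (0 : Horiz w) 1,
        F ((√(1 - ‖η‖ ^ 2) : ℂ) • w + (η : Cn N)) ∂lebesgue (Horiz w) := by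
  have hmap := map_toSphere_eq_hopfMeasure hw
  have hval : AEMeasurable ((↑) : Sph N → Cn N) (lebesgue (Cn N)).toSphere :=
    measurable_subtype_coe.aemeasurable
  have hchart := (continuous_hopfChart w).measurable.aemeasurable
    (μ := (volume.restrict (Set.Ioo (-Real.pi) Real.pi)).prod
      ((lebesgue (Horiz w)).restrict (Metric.ball 0 1)))
  have hint : Integrable F (hopfMeasure w) := by
    rw [← hmap, integrable_map_measure hF.aestronglyMeasurable hval]
    exact (hF.comp continuous_subtype_val).integrable_of_hasCompactSupport
      (HasCompactSupport.of_compactSpace _)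
  have hfiber (θ : ℝ) :
      ∫ η in Metric.ball (0 : Horiz w) 1, F (hopfChart w θ η) ∂lebesgue (Horiz w) =
        ∫ η in Metric.ball (0 : Horiz w) 1,
          F ((√(1 - ‖η‖ ^ 2) : ℂ) • w + (η : Cn N)) ∂lebesgue (Horiz w) := by
    rw [← setIntegral_ball_exp_smul (fun η => F (hopfChart w θ η)) θ]
    simp only [hopfChart_exp_smul, hinv]
  have hint' : Integrable (fun p : ℝ × Horiz w => F (hopfChart w p.1 p.2))
      ((volume.restrict (Set.Ioo (-Real.pi) Real.pi)).prod
        ((lebesgue (Horiz w)).restrict (Metric.ball 0 1))) :=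
    (integrable_map_measure hF.aestronglyMeasurable hchart).1 hint
  rw [← integral_map hval hF.aestronglyMeasurable, hmap, hopfMeasure,
    integral_map hchart hF.aestronglyMeasurable, integral_prod _ hint']
  simp only [hfiber]
  rw [integral_const, measureReal_restrict_apply_univ, Real.volume_real_Ioo_of_le
    (by linarith [Real.pi_pos]), Complex.real_smul]
  push_cast
  ring

theorem reducedState_exp_smul_mul_conj (k : ℕ) (A B : Matrix (Fin N) (Fin N) ℂ) (w z : Cn N)
    (t : ℝ) :
    reducedState k A w (Complex.exp (Complex.I * t) • z) *
        conj (reducedState k B w (Complex.exp (Complex.I * t) • z)) =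
      reducedState k A w z * conj (reducedState k B w z) := by
  simp only [reducedState, reduction_rotate, map_mul]
  rw [mul_mul_mul_comm, Complex.mul_conj, Complex.normSq_eq_norm_sq,
    norm_cexp_I_mul_natCast_mul, one_pow, Complex.ofReal_one, one_mul]

/-- The height over `(ℂ w)^⊥` at which `rescaledPoint k w _ u` lies on the unit sphere; it is the
junk value `0` for `‖u‖ > √k`. -/
def sphereHeight (k : ℕ) (u : Cn N) : ℝ := √(1 - ((√(k : ℝ))⁻¹ * ‖u‖) ^ 2)

theorem isAdmissible_sphereHeight {k : ℕ} (hk : k ≠ 0) (hw : ‖w‖ = 1) (u : Horiz w) :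
    IsAdmissible k w (sphereHeight k (u : Cn N)) u where
  ne_zero := hk
  norm_eq_one := hw
  inner_eq_zero := inner_horiz_eq_zero u
  nonneg := Real.sqrt_nonneg _
  le_one := Real.sqrt_le_one.2 (sub_le_self _ (sq_nonneg _))
  one_le := sub_le_iff_le_add.1 ((Real.sqrt_le_left (Real.sqrt_nonneg _)).1 le_rfl)

/-- The value of `√k Ψ_{A,w}` at the point of the unit sphere over `u / √k`. -/
def rescaledState (k : ℕ) (A : Matrix (Fin N) (Fin N) ℂ) (w u : Cn N) : ℂ :=
  √(k : ℝ) * reducedState k A w (rescaledPoint k w (sphereHeight k u) u)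

theorem continuous_rescaledState (k : ℕ) (A : Matrix (Fin N) (Fin N) ℂ) (w : Cn N) :
    Continuous (rescaledState k A w) := by
  have hpoint : Continuous fun u => rescaledPoint k w (sphereHeight k u) u := by
    unfold rescaledPoint sphereHeight; fun_prop
  exact continuous_const.mul ((continuous_reducedState k w).comp hpoint)

theorem rescaledState_mul_conj_eq (k : ℕ) (A B : Matrix (Fin N) (Fin N) ℂ) (u : Horiz w) :
    rescaledState k A w u * conj (rescaledState k B w u) =
      let z := (√(1 - ‖(√(k : ℝ))⁻¹ • u‖ ^ 2) : ℂ) • w + (((√(k : ℝ))⁻¹ • u : Horiz w) : Cn N)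
      (k : ℂ) * (reducedState k A w z * conj (reducedState k B w z)) := by
  have hk2 : (k : ℂ) = (√(k : ℝ) : ℂ) * (√(k : ℝ) : ℂ) := by
    rw [← Complex.ofReal_mul, Real.mul_self_sqrt (Nat.cast_nonneg k), Complex.ofReal_natCast]
  have hpoint : (√(1 - ‖(√(k : ℝ))⁻¹ • u‖ ^ 2) : ℂ) • w +
      (((√(k : ℝ))⁻¹ • u : Horiz w) : Cn N) =
        rescaledPoint k w (sphereHeight k (u : Cn N)) (u : Cn N) := by
    rw [rescaledPoint, sphereHeight, norm_smul, norm_inv, Real.norm_of_nonneg (Real.sqrt_nonneg _),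
      Submodule.norm_coe, ← Complex.ofReal_inv, Complex.coe_smul]
    rfl
  rw [hpoint, hk2]
  simp only [rescaledState, map_mul, Complex.conj_ofReal]
  ring

theorem sphereInner_reducedState (A B : Matrix (Fin N) (Fin N) ℂ) (hw : ‖w‖ = 1) {k : ℕ}
    (hk : k ≠ 0) :
    sphereInner (fun z : Sph N => reducedState k A w z) (fun z : Sph N => reducedState k B w z) =
      2 * Real.pi / (k : ℂ) ^ N *
        ∫ u in Metric.ball (0 : Horiz w) √(k : ℝ),
          rescaledState k A w u * conj (rescaledState k B w u) ∂lebesgue (Horiz w) := by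
  set F : Cn N → ℂ := fun z => reducedState k A w z * conj (reducedState k B w z)
  have hcont : Continuous F :=
    (continuous_reducedState k w).mul (Complex.continuous_conj.comp (continuous_reducedState k w))
  have hs : 0 < √(k : ℝ) := by positivity
  have hscale := Measure.setIntegral_comp_smul_of_pos (lebesgue (Horiz w))
    (fun η : Horiz w => F ((√(1 - ‖η‖ ^ 2) : ℂ) • w + (η : Cn N)))
    (Metric.ball (0 : Horiz w) √(k : ℝ)) (inv_pos.2 hs)
  rw [smul_ball (inv_ne_zero hs.ne'), smul_zero, norm_inv, Real.norm_of_nonneg hs.le,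
    inv_mul_cancel₀ hs.ne', finrank_real_horiz hw, pow_mul, inv_pow,
    Real.sq_sqrt (Nat.cast_nonneg k), inv_pow, inv_inv] at hscale
  simp only [rescaledState_mul_conj_eq]
  rw [integral_const_mul, hscale, Complex.real_smul]
  refine (integral_toSphere_eq hw hcont
    fun t z => reducedState_exp_smul_mul_conj k A B w z t).trans ?_
  obtain ⟨n, rfl⟩ := Nat.exists_eq_succ_of_ne_zero (ne_zero_of_norm_eq_one hw)
  have hk0 : (k : ℂ) ≠ 0 := by exact_mod_cast hk
  rw [Nat.succ_sub_one, pow_succ]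
  push_cast
  field_simp

end SphereIntegral

section SymmetrizedIntegral

variable {H : Type*} [AddGroup H] [MeasurableSpace H] [MeasurableNeg H] {μ : Measure H}
  [μ.IsNegInvariant] {s : Set H} {f g : H → ℂ} {h : H → ℝ}

theorem integrableOn_comp_neg (hs : -s = s) (hf : IntegrableOn f s μ) :
    IntegrableOn (fun v => f (-v)) s μ := by
  have := ((Measure.measurePreserving_neg μ).integrableOn_comp_preimage
    (MeasurableEquiv.neg H).measurableEmbedding).2 hf
  rwa [Set.neg_preimage, hs] at this

theorem setIntegral_add_neg (hs : -s = s) (hf : IntegrableOn f s μ) :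
    ∫ v in s, (f v + f (-v)) ∂μ = 2 * ∫ v in s, f v ∂μ := by
  have hval := (Measure.measurePreserving_neg μ).setIntegral_preimage_emb
    (MeasurableEquiv.neg H).measurableEmbedding f s
  rw [Set.neg_preimage, hs] at hval
  rw [integral_add hf (integrableOn_comp_neg hs hf), hval, two_mul]

/-- Only the even part of `f` on the symmetric set `s` has to be close to `g`. -/
theorem norm_setIntegral_sub_integral_le (hsymm : -s = s) (hs : MeasurableSet s)
    (hf : IntegrableOn f s μ) (hg : Integrable g μ) (hh : Integrable h μ)
    (hin : ∀ v ∈ s, ‖f v + f (-v) - 2 * g v‖ ≤ 2 * h v) (hout : ∀ v ∉ s, ‖g v‖ ≤ h v) :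
    ‖∫ v in s, f v ∂μ - ∫ v, g v ∂μ‖ ≤ ∫ v, h v ∂μ := by
  have hinside : ‖∫ v in s, f v ∂μ - ∫ v in s, g v ∂μ‖ ≤ ∫ v in s, h v ∂μ := by
    have hbound : ‖∫ v in s, (f v + f (-v) - 2 * g v) ∂μ‖ ≤ ∫ v in s, 2 * h v ∂μ :=
      norm_integral_le_of_norm_le (hh.integrableOn.const_mul 2)
        ((ae_restrict_iff' hs).2 (.of_forall hin))
    have hsum : IntegrableOn (fun v => f v + f (-v)) s μ :=
      hf.add (integrableOn_comp_neg hsymm hf)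
    rw [integral_sub hsum (hg.integrableOn.const_mul 2),
      setIntegral_add_neg hsymm hf, integral_const_mul, integral_const_mul, ← mul_sub, norm_mul,
      Complex.norm_ofNat] at hbound
    linarith
  have houtside : ‖∫ v in sᶜ, g v ∂μ‖ ≤ ∫ v in sᶜ, h v ∂μ :=
    norm_integral_le_of_norm_le hh.integrableOn
      ((ae_restrict_iff' hs.compl).2 (.of_forall hout))
  rw [← integral_add_compl hs hg, ← integral_add_compl hs hh, ← sub_sub]
  exact (norm_sub_le _ _).trans (add_le_add hinside houtside)

end SymmetrizedIntegral

section InnerProductAsymptotics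

variable {N : ℕ} {A B : Matrix (Fin N) (Fin N) ℂ} {w : Cn N}

theorem symbol_neg (A : Matrix (Fin N) (Fin N) ℂ) (w u : Cn N) :
    symbol A w (-u) = symbol A w u := by
  have hflip (s : ℝ) : symbolIntegrand A w (-u) s = symbolIntegrand A w u (-s) := by
    have : (Complex.I * s) • w + -u = -((Complex.I * ((-s : ℝ) : ℂ)) • w + u) := by
      push_cast; module
    rw [symbolIntegrand, this, quad_neg, symbolIntegrand]
    push_cast
    rw [neg_sq]
  rw [symbol, symbol, norm_neg, integral_congr_ae (.of_forall hflip), integral_neg_eq_self]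

theorem exp_neg_mul_mul_exp_neg_mul (a b x : ℝ) :
    Real.exp (-(a * x)) * Real.exp (-(b * x)) = Real.exp (-((a + b) * x)) := by
  rw [← Real.exp_add]
  ring_nf

theorem norm_mul_conj_add_mul_conj_sub_le (a₁ a₂ b₁ b₂ σ τ : ℂ) :
    ‖a₁ * conj b₁ + a₂ * conj b₂ - 2 * (σ * conj τ)‖ ≤
      ‖a₁ - σ‖ * ‖b₁ - τ‖ + ‖a₂ - σ‖ * ‖b₂ - τ‖ + ‖σ‖ * ‖b₁ + b₂ - 2 * τ‖ +
        ‖a₁ + a₂ - 2 * σ‖ * ‖τ‖ := by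
  have hsplit : a₁ * conj b₁ + a₂ * conj b₂ - 2 * (σ * conj τ) =
      (a₁ - σ) * conj (b₁ - τ) + (a₂ - σ) * conj (b₂ - τ) + σ * conj (b₁ + b₂ - 2 * τ) +
        (a₁ + a₂ - 2 * σ) * conj τ := by
    simp only [map_sub, map_add, map_mul, Complex.conj_ofNat]
    ring
  rw [hsplit]
  refine (norm_add₄_le).trans_eq ?_
  simp only [norm_mul, RCLike.norm_conj]

theorem integrable_symbol_mul_conj (hA : A ∈ disk N) (hB : B ∈ disk N) (hw : ‖w‖ = 1) :
    Integrable (fun η : Horiz w => symbol A w η * conj (symbol B w η)) (lebesgue (Horiz w)) :=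
  (memLp_two_symbol_horiz hA hw).integrable_mul (memLp_two_symbol_horiz hB hw).star

theorem exists_norm_rescaledState_mul_conj_add_neg_sub_le (hA : A.IsSymm) (hB : B.IsSymm)
    (hw : ‖w‖ = 1) {r r' : ℝ} (hr1 : r < 1) (hr : ∀ v : Cn N, ‖quad A v‖ ≤ r * ‖v‖ ^ 2)
    (hr1' : r' < 1) (hr' : ∀ v : Cn N, ‖quad B v‖ ≤ r' * ‖v‖ ^ 2) :
    ∃ C : ℝ, 0 ≤ C ∧ ∀ {k : ℕ}, k ≠ 0 → ∀ u : Horiz w,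
      ‖rescaledState k A w u * conj (rescaledState k B w u) +
          rescaledState k A w (-u) * conj (rescaledState k B w (-u)) -
            2 * (symbol A w u * conj (symbol B w u))‖ ≤
        C * (√(k : ℝ))⁻¹ ^ 2 * Real.exp (-(((1 - r) / 40 + (1 - r') / 40) * ‖u‖ ^ 2)) := by
  obtain ⟨a₀, ha₀, hA₀⟩ := exists_norm_symbol_le hw hr1 hr
  obtain ⟨b₀, hb₀, hB₀⟩ := exists_norm_symbol_le hw hr1' hr'
  obtain ⟨a₁, ha₁, hA₁⟩ := exists_norm_sqrt_mul_reducedState_sub_symbol_le hA hw hr1 hr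
  obtain ⟨b₁, hb₁, hB₁⟩ := exists_norm_sqrt_mul_reducedState_sub_symbol_le hB hw hr1' hr'
  obtain ⟨a₂, ha₂, hA₂⟩ := exists_norm_sqrt_mul_reducedState_add_neg_sub_symbol_le hA hw hr1 hr
  obtain ⟨b₂, hb₂, hB₂⟩ := exists_norm_sqrt_mul_reducedState_add_neg_sub_symbol_le hB hw hr1' hr'
  refine ⟨2 * (a₁ * b₁) + a₀ * b₂ + a₂ * b₀, by positivity, fun {k} hk u => ?_⟩
  have hadm := isAdmissible_sphereHeight hk hw u
  have hneg (M : Matrix (Fin N) (Fin N) ℂ) : rescaledState k M w (-u) =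
      √(k : ℝ) * reducedState k M w (rescaledPoint k w (sphereHeight k (u : Cn N)) (-u)) := by
    rw [rescaledState, sphereHeight, norm_neg, sphereHeight]
  have hminusA := hA₁ hadm.neg
  have hminusB := hB₁ hadm.neg
  rw [symbol_neg, norm_neg, ← hneg] at hminusA hminusB
  have hsumA := hA₂ hadm
  have hsumB := hB₂ hadm
  rw [← hneg] at hsumA hsumB
  refine (norm_mul_conj_add_mul_conj_sub_le _ _ _ _ _ _).trans ?_
  rw [← exp_neg_mul_mul_exp_neg_mul, Submodule.coe_norm]
  refine (add_le_add (add_le_add (add_le_add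
    (mul_le_mul (hA₁ hadm) (hB₁ hadm) (norm_nonneg _) (by positivity))
    (mul_le_mul hminusA hminusB (norm_nonneg _) (by positivity)))
    (mul_le_mul (hA₀ u hadm.inner_eq_zero) hsumB (norm_nonneg _) (by positivity)))
    (mul_le_mul hsumA (hB₀ u hadm.inner_eq_zero) (norm_nonneg _) (by positivity))).trans_eq ?_
  ring

theorem exists_norm_symbol_mul_conj_le_of_sqrt_le (hw : ‖w‖ = 1) {r r' : ℝ} (hr1 : r < 1)
    (hr : ∀ v : Cn N, ‖quad A v‖ ≤ r * ‖v‖ ^ 2) (hr1' : r' < 1)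
    (hr' : ∀ v : Cn N, ‖quad B v‖ ≤ r' * ‖v‖ ^ 2) :
    ∃ C : ℝ, 0 ≤ C ∧ ∀ {k : ℕ}, k ≠ 0 → ∀ u : Horiz w, √(k : ℝ) ≤ ‖u‖ →
      ‖symbol A w u * conj (symbol B w u)‖ ≤
        C * (√(k : ℝ))⁻¹ ^ 2 * Real.exp (-(((1 - r) / 40 + (1 - r') / 40) / 2 * ‖u‖ ^ 2)) := by
  obtain ⟨C₁, hC₁, hA⟩ := exists_norm_symbol_le hw hr1 hr
  obtain ⟨C₂, hC₂, hB⟩ := exists_norm_symbol_le hw hr1' hr'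
  obtain ⟨C, hC0, hC⟩ := exists_pow_mul_exp_le (a := (1 - r) / 40 + (1 - r') / 40) (by linarith) 2
  refine ⟨C₁ * C₂ * C, by positivity, fun {k} hk u hu => ?_⟩
  have hs : 0 < √(k : ℝ) := by positivity
  have hone : 1 ≤ (√(k : ℝ))⁻¹ ^ 2 * (1 + ‖u‖) ^ 2 := by
    rw [← mul_pow]
    refine one_le_pow₀ ?_
    rw [inv_mul_eq_div, one_le_div hs]
    linarith
  set b := (1 - r) / 40 + (1 - r') / 40
  calc ‖symbol A w u * conj (symbol B w u)‖
      ≤ (C₁ * Real.exp (-((1 - r) / 40 * ‖(u : Cn N)‖ ^ 2))) *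
          (C₂ * Real.exp (-((1 - r') / 40 * ‖(u : Cn N)‖ ^ 2))) := by
        rw [norm_mul, RCLike.norm_conj]
        gcongr
        exacts [hA u (inner_horiz_eq_zero u), hB u (inner_horiz_eq_zero u)]
    _ = C₁ * C₂ * Real.exp (-(b * ‖u‖ ^ 2)) * 1 := by
        rw [mul_mul_mul_comm, exp_neg_mul_mul_exp_neg_mul, Submodule.coe_norm, mul_one]
    _ ≤ C₁ * C₂ * Real.exp (-(b * ‖u‖ ^ 2)) * ((√(k : ℝ))⁻¹ ^ 2 * (1 + ‖u‖) ^ 2) := by gcongr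
    _ = C₁ * C₂ * (√(k : ℝ))⁻¹ ^ 2 * ((1 + ‖u‖) ^ 2 * Real.exp (-(b * ‖u‖ ^ 2))) := by ring
    _ ≤ C₁ * C₂ * (√(k : ℝ))⁻¹ ^ 2 * (C * Real.exp (-(b / 2 * ‖u‖ ^ 2))) := by
        gcongr _ * ?_; exact hC _ (norm_nonneg u)
    _ = C₁ * C₂ * C * (√(k : ℝ))⁻¹ ^ 2 * Real.exp (-(b / 2 * ‖u‖ ^ 2)) := by ring

theorem integrableOn_ball_rescaledState_mul_conj (k : ℕ) (A B : Matrix (Fin N) (Fin N) ℂ)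
    (w : Cn N) (R : ℝ) :
    IntegrableOn (fun u : Horiz w => rescaledState k A w u * conj (rescaledState k B w u))
      (Metric.ball 0 R) (lebesgue (Horiz w)) := by
  have hcont : Continuous fun u : Cn N => rescaledState k A w u * conj (rescaledState k B w u) :=
    (continuous_rescaledState k A w).mul
      (Complex.continuous_conj.comp (continuous_rescaledState k B w))
  exact ((hcont.comp continuous_subtype_val).continuousOn.integrableOn_compact
    (isCompact_closedBall 0 R)).mono_set Metric.ball_subset_closedBall

theorem exists_norm_setIntegral_rescaledState_sub_le (hA : A ∈ disk N) (hB : B ∈ disk N)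
    (hw : ‖w‖ = 1) :
    ∃ C : ℝ, ∀ k : ℕ, k ≠ 0 →
      ‖∫ u in Metric.ball (0 : Horiz w) √(k : ℝ),
            rescaledState k A w u * conj (rescaledState k B w u) ∂lebesgue (Horiz w) -
          ∫ u : Horiz w, symbol A w u * conj (symbol B w u) ∂lebesgue (Horiz w)‖ ≤
        C * (k : ℝ)⁻¹ := by
  obtain ⟨r, hr1, hr⟩ := exists_norm_quad_le hA
  obtain ⟨r', hr1', hr'⟩ := exists_norm_quad_le hB
  obtain ⟨C₁, hC₁0, hC₁⟩ :=
    exists_norm_rescaledState_mul_conj_add_neg_sub_le hA.1 hB.1 hw hr1 hr hr1' hr'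
  obtain ⟨C₂, hC₂0, hC₂⟩ := exists_norm_symbol_mul_conj_le_of_sqrt_le hw hr1 hr hr1' hr'
  set b := (1 - r) / 40 + (1 - r') / 40 with hb
  have hb0 : 0 < b / 2 := by rw [hb]; linarith
  refine ⟨(C₁ + C₂) * ∫ u : Horiz w, Real.exp (-(b / 2 * ‖u‖ ^ 2)) ∂lebesgue (Horiz w),
    fun k hk => ?_⟩
  have hk2 : (√(k : ℝ))⁻¹ ^ 2 = (k : ℝ)⁻¹ := by rw [inv_pow, Real.sq_sqrt (Nat.cast_nonneg k)]
  refine (norm_setIntegral_sub_integral_le (by simp) measurableSet_ball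
    (integrableOn_ball_rescaledState_mul_conj k A B w _)
    (integrable_symbol_mul_conj hA hB hw)
    ((integrable_exp_neg_mul_norm_sq (Horiz w) hb0).const_mul ((C₁ + C₂) * (√(k : ℝ))⁻¹ ^ 2))
    (fun u _ => ?_) (fun u hu => ?_)).trans_eq ?_
  · refine (hC₁ hk u).trans ?_
    rw [← mul_assoc, ← mul_assoc]
    gcongr <;> linarith
  · refine (hC₂ hk u (by simpa using hu)).trans ?_
    gcongr
    linarith
  · rw [integral_const_mul, hk2]
    ring

theorem sphereInner_sub_isBigO (hA : A ∈ disk N) (hB : B ∈ disk N) (hw : ‖w‖ = 1) :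
    (fun k : ℕ =>
        sphereInner (fun z : Sph N => reducedState k A w z)
            (fun z : Sph N => reducedState k B w z) -
          (2 * Real.pi / (k : ℂ) ^ N) *
            ∫ η : Horiz w, symbol A w η * conj (symbol B w η) ∂(lebesgue (Horiz w)))
      =O[atTop] fun k : ℕ => ((k : ℝ) ^ (N + 1))⁻¹ := by
  obtain ⟨C, hC⟩ := exists_norm_setIntegral_rescaledState_sub_le hA hB hw
  refine IsBigO.of_bound (2 * Real.pi * C) ?_
  filter_upwards [eventually_ne_atTop 0] with k hk
  rw [sphereInner_reducedState A B hw hk, ← mul_sub, norm_mul, norm_div, norm_mul,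
    Complex.norm_ofNat, Complex.norm_real, Real.norm_of_nonneg Real.pi_pos.le, norm_pow,
    Complex.norm_natCast, Real.norm_of_nonneg (by positivity)]
  have : (0 : ℝ) < k := by positivity
  calc _ ≤ 2 * Real.pi / (k : ℝ) ^ N * (C * (k : ℝ)⁻¹) := by gcongr; exact hC k hk
    _ = _ := by rw [pow_succ]; field_simp

end InnerProductAsymptotics

end ReducedGaussian

end

theorem theorem1p2 (N : ℕ) (A : Matrix (Fin N) (Fin N) ℂ) (hA : A ∈ disk N) (w : Sph N) :
    -- (1) micro-support: in `ℂ^N`, on the unit sphere, and as a section over `ℂP^{N-1}`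
    (microSupport (fun k (z : Cn N) => ‖reducedState k A w z‖) =
        {z | ∃ t ∈ Set.Icc (0 : ℝ) (2 * Real.pi), z = Complex.exp (Complex.I * t) • (w : Cn N)} ∧
      microSupport (fun k (z : Sph N) => ‖reducedState k A w z‖) =
        {z | ∃ t ∈ Set.Icc (0 : ℝ) (2 * Real.pi), z = rotate t w} ∧
      microSupport (fun k (p : CP N) => (reducedSection k A w p).size) = {hopf w}) ∧
    -- (2) the rescaled limit and its closed form
    ((∀ η ∈ Horiz (w : Cn N),
        Integrable (symbolIntegrand A w η) ∧
        Tendsto (fun k : ℕ => (√(k : ℝ) : ℂ) *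
            reducedState k A w ((w : Cn N) + ((√(k : ℝ))⁻¹ : ℂ) • η))
          atTop (𝓝 (symbol A w η))) ∧
      0 < (quad A w + 1).re ∧
      ∃ Q ∈ formDisk (Horiz (w : Cn N)), ∀ η : Horiz (w : Cn N),
        symbol A w η = (1 / √(2 * Real.pi) : ℂ) * (1 / (quad A w + 1) ^ (1 / 2 : ℂ)) *
          Complex.exp (Q η / 2) * Complex.exp (-(‖η‖ : ℂ) ^ 2 / 2)) ∧
    -- (3) inner products
    (∀ B ∈ disk N,
      Integrable (fun η : Horiz (w : Cn N) => symbol A w η * conj (symbol B w η))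
        (lebesgue (Horiz (w : Cn N))) ∧
      (fun k : ℕ => sphereInner (fun z : Sph N => reducedState k A w z) (fun z : Sph N => reducedState k B w z) -
          (2 * Real.pi / (k : ℂ) ^ N) *
            ∫ η : Horiz (w : Cn N), symbol A w η * conj (symbol B w η)
              ∂(lebesgue (Horiz (w : Cn N))))
        =O[atTop] fun k : ℕ => ((k : ℝ) ^ (N + 1))⁻¹) := by
  have hw : ‖(w : Cn N)‖ = 1 := norm_eq_of_mem_sphere w
  have hre := re_quad_add_one_pos hA hw
  refine ⟨⟨microSupport_reducedState hA hw, microSupport_reducedState_sphere hA w,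
      microSupport_reducedSection hA w⟩,
    ⟨fun η hη => ?_, hre, reducedForm A w, reducedForm_mem_formDisk hA hw,
      symbol_eq_reducedForm hA.1 hre⟩,
    fun B hB => ⟨integrable_symbol_mul_conj hA hB hw, sphereInner_sub_isBigO hA hB hw⟩⟩
  have hη := Submodule.mem_orthogonal_singleton_iff_inner_right.1 hη
  exact ⟨integrable_symbolIntegrand hA hw hη, tendsto_sqrt_mul_reducedState hA hw hη⟩
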